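/- A \emph{triangle-forest} is a graph with no cycle of length at least four. There is a finite planar graph whose vertex set cannot be partitioned into two (possibly empty) sets, one inducing a forest and the other inducing a triangle-forest. More precisely, there is a finite simple plane graph $H$ that is cubic, $3$-connected, cyclically $4$-edge-connected (every set of edges whose removal leaves a disconnected graph each component of which contains a cycle has at least four edges) and not Hamiltonian, such that the following graph $G'$ is planar and has no such vertex partition. Let $G$ be the dual graph of $H$; its faces are triangles, one for each vertex of $H$. The graph $G'$ is obtained from $G$ by stacking an octahedron into every face of $G$: into each face with corners $c_1,c_2,c_3$ one puts a new triangle $t_1t_2t_3$ and joins $t_1$ to $c_1,c_2$, $t_2$ to $c_2,c_3$, and $t_3$ to $c_3,c_1$. -/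

import Mathlib

namespace PlanarPartition

/-- A triangle-forest: a graph with no cycle of length at least four. -/
def IsTriangleForest {V : Type*} (G : SimpleGraph V) : Prop :=
  ∀ (v : V) (c : G.Walk v v), c.IsCycle → ¬ 4 ≤ c.length

/-- The vertex set of `G` can be partitioned into two (possibly empty) sets, the first inducing a
forest and the second inducing a triangle-forest. -/
def HasForestTriangleForestPartition {V : Type*} (G : SimpleGraph V) : Prop :=
  ∃ A : Set V, (G.induce A).IsAcyclic ∧ IsTriangleForest (G.induce Aᶜ)

/-- A rotation system of `G`: a cyclic ordering of the darts (oriented edges) leaving each vertex,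
given by the permutation sending a dart to its successor around its initial vertex. This is the
usual combinatorial description of an embedding of `G` in oriented closed surfaces, one for each
component. -/
structure RotationSystem {V : Type*} (G : SimpleGraph V) where
  next : Equiv.Perm G.Dart
  next_fst : ∀ d, (next d).fst = d.fst
  sameCycle : ∀ d e : G.Dart, d.fst = e.fst → next.SameCycle d e

namespace RotationSystem

variable {V : Type*} {G : SimpleGraph V} (R : RotationSystem G)

/-- One step of face tracing: run along the dart, then leave its end point along the dart that
follows the reversed dart in the rotation. -/
def faceStep : Equiv.Perm G.Dart :=
  (SimpleGraph.Dart.symm_involutive.toPerm SimpleGraph.Dart.symm).trans R.next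

/-- The faces (of the components with at least one edge): the orbits of face tracing. -/
def Face : Type _ := Quotient (Equiv.Perm.SameCycle.setoid R.faceStep)

/-- The face on a fixed side of the dart `d`; the face on the other side of the same edge is
`R.face d.symm`. -/
def face (d : G.Dart) : R.Face := Quotient.mk _ d

/-- The embedding has genus zero: Euler's formula `V - E + F = 2` summed over all components.
An isolated vertex has one face around it, which is not an orbit of darts and is counted
separately. (Each component satisfies `V - E + F ≤ 2`, hence equality of the sums means equality
for each component.) -/
def IsPlane : Prop :=
  Nat.card V + (Nat.card R.Face + Nat.card {v : V // ∀ w, ¬ G.Adj v w}) =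
    Nat.card G.edgeSet + 2 * Nat.card G.ConnectedComponent

/-- The dual graph: its vertices are the faces, and two different faces are adjacent if they lie
on the two sides of some edge. (For a plane `3`-connected graph the dual has no loops and no
multiple edges, so the simple graph loses nothing.) -/
def dual : SimpleGraph R.Face where
  Adj f g := f ≠ g ∧ ∃ d : G.Dart, R.face d = f ∧ R.face d.symm = g
  symm := ⟨by
    rintro f g ⟨h, d, rfl, rfl⟩
    exact ⟨h.symm, d.symm, rfl, by simp⟩⟩
  loopless := ⟨fun _ h => h.1 rfl⟩

/-- The graph obtained from the dual of a plane cubic graph `G` by stacking an octahedron into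
every face of the dual. The faces of the dual are the vertices `v` of `G`; the face `v` is a
triangle whose three sides are the dual edges of the three darts leaving `v`. Into the face `v` we
put a new triangle whose three vertices are these three darts, and the new vertex `d` is joined to
the two end points `R.face d` and `R.face d.symm` of the side of the face dual to `d`.
The three corners of the face and the three new vertices then induce an octahedron. -/
def octahedralStackedDual : SimpleGraph (R.Face ⊕ G.Dart) where
  Adj
    | .inl f, .inl g => R.dual.Adj f g
    | .inl f, .inr d => f = R.face d ∨ f = R.face d.symm
    | .inr d, .inl f => f = R.face d ∨ f = R.face d.symm
    | .inr d, .inr e => d ≠ e ∧ d.fst = e.fst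
  symm := ⟨by
    rintro (f | d) (g | e) h
    · exact R.dual.adj_symm h
    · exact h
    · exact h
    · exact ⟨h.1.symm, h.2.symm⟩⟩
  loopless := ⟨by
    rintro (f | d) h
    · exact h.1 rfl
    · exact h.1 rfl⟩

end RotationSystem

/-- A (finite) planar graph: a finite graph that has an embedding of genus zero. -/
def IsPlanar {V : Type*} (G : SimpleGraph V) : Prop :=
  Finite V ∧ ∃ R : RotationSystem G, R.IsPlane

/-- Every vertex has exactly three neighbours. -/
def IsCubic {V : Type*} (G : SimpleGraph V) : Prop :=
  ∀ v, (G.neighborSet v).ncard = 3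

/-- More than three vertices, and no set of at most two vertices separates the graph. -/
def IsThreeConnected {V : Type*} (G : SimpleGraph V) : Prop :=
  3 < Nat.card V ∧ ∀ S : Set V, S.ncard < 3 → (G.induce Sᶜ).Connected

/-- A cyclic edge-cut: a set of edges whose removal disconnects the graph in such a way that each
component of the remaining graph contains a cycle. -/
def IsCyclicEdgeCut {V : Type*} (G : SimpleGraph V) (F : Set (Sym2 V)) : Prop :=
  F ⊆ G.edgeSet ∧ ¬ (G.deleteEdges F).Connected ∧
    ∀ K : (G.deleteEdges F).ConnectedComponent,
      ∃ v ∈ K.supp, ∃ c : (G.deleteEdges F).Walk v v, c.IsCycle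

/-- Connected, and every cyclic edge-cut has at least four edges (the graph is finite). -/
def IsCyclicallyFourEdgeConnected {V : Type*} (G : SimpleGraph V) : Prop :=
  G.Connected ∧ ∀ F : Set (Sym2 V), IsCyclicEdgeCut G F → 4 ≤ F.ncard

end PlanarPartition

/-! The witness is the Grinberg graph on 42 vertices, whose faces have sizes 4 (once), 5 (18 times)
and 8 (four times); all sizes except the single 4 are congruent to 2 modulo 3.

Suppose `A` induced a forest and its complement a triangle-forest in the stacked dual, and let `S`
be the set of dual vertices in `A`. No dual triangle lies inside `S`, and the octahedra prevent one
from lying outside `S`: a new vertex outside `A` would close a 4-cycle with three corners outside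
`A`, while three new vertices in `A` form a triangle. As every dual triangle is facial, both sides
of `S` induce forests in the dual. A Hamiltonian cycle would likewise split the faces into two sides
that are connected in the dual, with the three faces at each vertex never on one side.

`grinberg` excludes both situations. Write `V` and `F` for the numbers of vertices and faces of the
cubic graph. Each vertex sees one boundary dart of `S`, so the face sizes in `S` sum to `2 e(S) +
V`. Adding the count for the complement and using `V + 4 = 2F`, which is Euler's formula for cubic
maps, gives `e(S) + e(Sᶜ) = |S| + |Sᶜ| - 2`. Two forests, or two connected sides, must therefore be
trees. On the side without the quadrilateral the face sizes sum to `2|S|` modulo 3, whence `V ≡ 2`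
modulo 3, but 42 is divisible by 3.

Everything needed about the graph is collected in `IsSimplicialCubic`. Connectivity follows because
a small edge cut corresponds to a short closed walk in the dual, and dual triangles are facial. The
fields of `IsSimplicialCubic` are checked by kernel evaluation on explicit tables. -/

namespace PlanarPartition

open SimpleGraph

/-! ### Simplicial cubic maps and Grinberg's counting criterion. -/

namespace RotationSystem

variable {V : Type*} {G : SimpleGraph V} (R : RotationSystem G)

lemma faceStep_apply (d : G.Dart) : R.faceStep d = R.next d.symm := rfl

lemma faceStep_symm (d : G.Dart) : R.faceStep d.symm = R.next d := by
  rw [faceStep_apply, Dart.symm_symm]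

lemma face_eq_iff {d e : G.Dart} : R.face d = R.face e ↔ R.faceStep.SameCycle d e :=
  Quotient.eq (r := Equiv.Perm.SameCycle.setoid R.faceStep)

lemma face_surjective (f : R.Face) : ∃ d, R.face d = f := Quotient.exists_rep f

lemma face_faceStep (d : G.Dart) : R.face (R.faceStep d) = R.face d := by
  rw [face_eq_iff]
  exact Equiv.Perm.sameCycle_apply_left.2 (Equiv.Perm.SameCycle.refl _ _)

lemma face_next (d : G.Dart) : R.face (R.next d) = R.face d.symm := by
  rw [← faceStep_symm, face_faceStep]

lemma faceStep_fst (d : G.Dart) : (R.faceStep d).fst = d.snd := by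
  rw [faceStep_apply, next_fst]; rfl

instance [Finite V] : Finite G.Dart :=
  Finite.of_injective (fun d ↦ d.toProd) Dart.toProd_injective

instance [Finite V] : Finite R.Face := Quotient.finite _

/-- A connected cubic plane map whose dual is a simple triangulation without separating
triangles. -/
structure IsSimplicialCubic : Prop where
  connected : G.Connected
  exists_dart : ∀ v, ∃ d : G.Dart, d.fst = v
  next_three : ∀ d, R.next (R.next (R.next d)) = d
  next_ne : ∀ d, R.next d ≠ d
  card : Nat.card V + 4 = 2 * Nat.card R.Face
  face_ne : ∀ d, R.face d ≠ R.face d.symm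
  dual_simple : ∀ d e, R.face d = R.face e → R.face d.symm = R.face e.symm → d = e
  triangle_facial : ∀ d h, R.dual.Adj (R.face d) h → R.dual.Adj (R.face d.symm) h →
    h = R.face (R.next (R.next d)) ∨ h = R.face (R.next (R.next d.symm))

namespace IsSimplicialCubic

variable {R} (hR : R.IsSimplicialCubic)
include hR

lemma next_next_ne (d : G.Dart) : R.next (R.next d) ≠ d := by
  intro h
  have := hR.next_three d
  rw [h] at this
  exact hR.next_ne d this

lemma eq_or_of_fst_eq {d e : G.Dart} (h : d.fst = e.fst) :
    e = d ∨ e = R.next d ∨ e = R.next (R.next d) := by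
  obtain ⟨i, rfl⟩ := R.sameCycle d e h
  have h3 : R.next ^ (3 : ℤ) = 1 := by
    ext1 d
    exact hR.next_three d
  have hi : R.next ^ i = R.next ^ (i % 3) := by
    conv_lhs => rw [← Int.mul_ediv_add_emod i 3, zpow_add, zpow_mul, h3, one_zpow, one_mul]
  rw [hi]
  have h0 := Int.emod_nonneg i (b := 3) (by norm_num)
  have h1 := Int.emod_lt_of_pos i (b := 3) (by norm_num)
  generalize i % 3 = j at *
  obtain rfl | rfl | rfl : j = 0 ∨ j = 1 ∨ j = 2 := by lia
  · left; rfl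
  · right; left; rfl
  · right; right; rfl

/-- The darts leaving `v` are listed by the powers of the rotation applied to one of them. -/
lemma exists_dart_equiv : ∃ e : V × Fin 3 ≃ G.Dart, ∀ v i, (e (v, i)).fst = v ∧
    e (v, i + 1) = R.next (e (v, i)) := by
  choose b hb using hR.exists_dart
  let f : V × Fin 3 → G.Dart := fun p ↦ ![b p.1, R.next (b p.1), R.next (R.next (b p.1))] p.2
  have hf : ∀ v i, (f (v, i)).fst = v := by
    intro v i
    fin_cases i <;> simp [f, R.next_fst, hb]
  have hinj : f.Injective := by
    rintro ⟨v, i⟩ ⟨w, j⟩ h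
    obtain rfl : v = w := by rw [← hf v i, h, hf]
    have h1 := hR.next_ne (b v)
    have h2 := hR.next_next_ne (b v)
    have h3 := hR.next_ne (R.next (b v))
    fin_cases i <;> fin_cases j <;> first
      | rfl
      | exact absurd h h1
      | exact absurd h h1.symm
      | exact absurd h h2
      | exact absurd h h2.symm
      | exact absurd h h3
      | exact absurd h h3.symm
  have hsurj : f.Surjective := by
    intro d
    rcases hR.eq_or_of_fst_eq (hb d.fst) with h | h | h
    · exact ⟨(d.fst, 0), h.symm⟩
    · exact ⟨(d.fst, 1), h.symm⟩
    · exact ⟨(d.fst, 2), h.symm⟩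
  refine ⟨Equiv.ofBijective f ⟨hinj, hsurj⟩, fun v i ↦ ⟨hf v i, ?_⟩⟩
  fin_cases i
  · rfl
  · rfl
  · exact (hR.next_three _).symm

lemma card_dart [Finite V] : Nat.card G.Dart = 3 * Nat.card V := by
  obtain ⟨e, -⟩ := hR.exists_dart_equiv
  rw [← Nat.card_congr e, Nat.card_prod, Nat.card_eq_fintype_card (α := Fin 3), Fintype.card_fin,
    mul_comm]

lemma dual_adj_face (d : G.Dart) : R.dual.Adj (R.face d) (R.face d.symm) :=
  ⟨hR.face_ne d, d, rfl, rfl⟩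

lemma face_next_next_symm (d : G.Dart) : R.face (R.next (R.next d)).symm = R.face d := by
  rw [← R.face_next, hR.next_three]

/-- If the faces around each vertex are not all on the same side of `S`, then each vertex has
exactly one dart leading along the boundary of `S` with `S` on its fixed side. -/
lemma card_boundary [Finite V] (S : Set R.Face)
    (h1 : ∀ d, ¬ (R.face d ∈ S ∧ R.face (R.next d) ∈ S ∧ R.face (R.next (R.next d)) ∈ S))
    (h2 : ∀ d, ¬ (R.face d ∉ S ∧ R.face (R.next d) ∉ S ∧ R.face (R.next (R.next d)) ∉ S)) :
    Nat.card {d : G.Dart // R.face d ∈ S ∧ R.face d.symm ∉ S} = Nat.card V := by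
  refine Nat.card_congr (Equiv.ofBijective (fun d ↦ d.1.fst) ⟨?_, ?_⟩)
  · rintro ⟨d, hd⟩ ⟨e, he⟩ h
    have hn := R.face_next d
    have hnn := R.face_next (R.next d)
    have hs := hR.face_next_next_symm d
    simp only [Subtype.mk.injEq]
    rcases hR.eq_or_of_fst_eq h with rfl | rfl | rfl
    · rfl
    · rw [← hn] at hd
      exact absurd he.1 hd.2
    · rw [hs] at he
      exact absurd hd.1 he.2
  · intro v
    obtain ⟨d, rfl⟩ := hR.exists_dart v
    have hn := R.face_next d
    have hnn := R.face_next (R.next d)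
    have hs := hR.face_next_next_symm d
    have h1 := h1 d
    have h2 := h2 d
    by_cases a : R.face d ∈ S <;> by_cases b : R.face (R.next d) ∈ S <;>
      by_cases c : R.face (R.next (R.next d)) ∈ S
    · exact absurd ⟨a, b, c⟩ h1
    · exact ⟨⟨R.next d, b, hnn ▸ c⟩, R.next_fst d⟩
    · exact ⟨⟨d, a, hn ▸ b⟩, rfl⟩
    · exact ⟨⟨d, a, hn ▸ b⟩, rfl⟩
    · exact ⟨⟨R.next (R.next d), c, hs ▸ a⟩, by simp [R.next_fst]⟩
    · exact ⟨⟨R.next d, b, hnn ▸ c⟩, R.next_fst d⟩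
    · exact ⟨⟨R.next (R.next d), c, hs ▸ a⟩, by simp [R.next_fst]⟩
    · exact absurd ⟨a, b, c⟩ h2

/-- The darts whose two faces lie in `S` are the darts of the dual induced by `S`. -/
lemma card_inside [Finite V] (S : Set R.Face) :
    Nat.card {d : G.Dart // R.face d ∈ S ∧ R.face d.symm ∈ S} =
      2 * Nat.card (R.dual.induce S).edgeSet := by
  classical
  have := Fintype.ofFinite R.Face
  rw [Nat.card_eq_fintype_card (α := (R.dual.induce S).edgeSet), card_edgeSet,
    ← dart_card_eq_twice_card_edges, ← Nat.card_eq_fintype_card]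
  refine Nat.card_congr (Equiv.ofBijective
    (fun d ↦ ⟨(⟨R.face d.1, d.2.1⟩, ⟨R.face d.1.symm, d.2.2⟩), hR.dual_adj_face d.1⟩) ⟨?_, ?_⟩)
  · rintro ⟨d, hd⟩ ⟨e, he⟩ h
    exact Subtype.ext (hR.dual_simple d e
      (congrArg (fun x : (R.dual.induce S).Dart ↦ x.fst.1) h)
      (congrArg (fun x : (R.dual.induce S).Dart ↦ x.snd.1) h))
  · rintro ⟨⟨⟨f, hf⟩, ⟨g, hg⟩⟩, h⟩
    obtain ⟨-, d, hd, hd'⟩ := h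
    replace hd : R.face d = f := hd
    replace hd' : R.face d.symm = g := hd'
    exact ⟨⟨d, hd ▸ hf, hd' ▸ hg⟩, Dart.ext _ _ (Prod.ext (Subtype.ext hd) (Subtype.ext hd'))⟩

/-- Darts on faces of `S` either have `S` on both sides, which counts each inner dual edge twice, or
are boundary darts, one per vertex. -/
lemma card_face_mem [Finite V] (S : Set R.Face)
    (h1 : ∀ d, ¬ (R.face d ∈ S ∧ R.face (R.next d) ∈ S ∧ R.face (R.next (R.next d)) ∈ S))
    (h2 : ∀ d, ¬ (R.face d ∉ S ∧ R.face (R.next d) ∉ S ∧ R.face (R.next (R.next d)) ∉ S)) :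
    Nat.card {d : G.Dart // R.face d ∈ S} =
      2 * Nat.card (R.dual.induce S).edgeSet + Nat.card V := by
  classical
  rw [← hR.card_boundary S h1 h2, ← hR.card_inside, ← Nat.card_sum]
  refine Nat.card_congr ?_
  refine (Equiv.sumCompl (fun d : {d : G.Dart // R.face d ∈ S} ↦ R.face d.1.symm ∈ S)).symm.trans
    (Equiv.sumCongr ?_ ?_)
  · exact ⟨fun d ↦ ⟨d.1.1, d.1.2, d.2⟩, fun d ↦ ⟨⟨d.1, d.2.1⟩, d.2.2⟩, fun _ ↦ rfl, fun _ ↦ rfl⟩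
  · exact ⟨fun d ↦ ⟨d.1.1, d.1.2, d.2⟩, fun d ↦ ⟨⟨d.1, d.2.1⟩, d.2.2⟩, fun _ ↦ rfl, fun _ ↦ rfl⟩

lemma card_face_mem_add [Finite V] (S : Set R.Face) :
    Nat.card {d : G.Dart // R.face d ∈ S} + Nat.card {d : G.Dart // R.face d ∈ Sᶜ} =
      3 * Nat.card V := by
  classical
  rw [← hR.card_dart, ← Nat.card_sum]
  exact Nat.card_congr (Equiv.sumCompl _)

omit hR in
lemma card_face_mem_mod [Finite V] (S : Set R.Face)
    (hS : ∀ f ∈ S, Nat.card {d : G.Dart // R.face d = f} % 3 = 2) :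
    Nat.card {d : G.Dart // R.face d ∈ S} % 3 = 2 * Nat.card S % 3 := by
  classical
  have := Fintype.ofFinite S
  have e : {d : G.Dart // R.face d ∈ S} ≃ Σ f : S, {d : G.Dart // R.face d = f} :=
    { toFun := fun d ↦ ⟨⟨_, d.2⟩, ⟨d.1, rfl⟩⟩
      invFun := fun p ↦ ⟨p.2.1, by rw [p.2.2]; exact p.1.2⟩
      left_inv := fun _ ↦ rfl
      right_inv := by rintro ⟨⟨f, hf⟩, ⟨d, hd : R.face d = f⟩⟩; subst hd; rfl }
  rw [Nat.card_congr e, Nat.card_sigma, Finset.sum_nat_mod, Finset.sum_congr rfl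
    (fun f _ ↦ hS f.1 f.2), Finset.sum_const, Finset.card_univ, Nat.card_eq_fintype_card,
    smul_eq_mul, mul_comm]

/-- Grinberg's criterion: if all faces but one have a size congruent to `2` modulo `3`, then the
faces cannot be partitioned into two sets both inducing trees in the dual. -/
theorem grinberg [Finite V] (hV : Nat.card V % 3 ≠ 2) (f₀ : R.Face)
    (hf₀ : ∀ f ≠ f₀, Nat.card {d : G.Dart // R.face d = f} % 3 = 2) (S : Set R.Face)
    (h1 : ∀ d, ¬ (R.face d ∈ S ∧ R.face (R.next d) ∈ S ∧ R.face (R.next (R.next d)) ∈ S))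
    (h2 : ∀ d, ¬ (R.face d ∉ S ∧ R.face (R.next d) ∉ S ∧ R.face (R.next (R.next d)) ∉ S))
    (h : (Nat.card (R.dual.induce S).edgeSet + 1 ≤ Nat.card S ∧
        Nat.card (R.dual.induce Sᶜ).edgeSet + 1 ≤ Nat.card (Sᶜ : Set R.Face)) ∨
      (Nat.card S ≤ Nat.card (R.dual.induce S).edgeSet + 1 ∧
        Nat.card (Sᶜ : Set R.Face) ≤ Nat.card (R.dual.induce Sᶜ).edgeSet + 1)) : False := by
  have a := hR.card_face_mem S h1 h2
  have b := hR.card_face_mem Sᶜ h2 (by simpa using h1)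
  have c := hR.card_face_mem_add S
  have d := Set.ncard_add_ncard_compl S
  rw [← Nat.card_coe_set_eq, ← Nat.card_coe_set_eq] at d
  have e := hR.card
  -- The counts force equality in both inequalities of either alternative of `h`. Reducing modulo 3
  -- on the side that avoids `f₀` then gives `V ≡ 2`.
  by_cases hS : f₀ ∈ S
  · have := card_face_mem_mod Sᶜ (fun f hf ↦ hf₀ f (by rintro rfl; exact hf hS))
    lia
  · have := card_face_mem_mod S (fun f hf ↦ hf₀ f (by rintro rfl; exact hS hf))
    lia

end IsSimplicialCubic
end RotationSystem
end PlanarPartition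

/-! ### Small cuts: cyclic edge-connectivity, 3-connectivity, cubicity. -/

namespace PlanarPartition

open SimpleGraph

namespace RotationSystem

variable {V : Type*} {G : SimpleGraph V} {R : RotationSystem G}

/-- A vertex colouring that changes along a dart changes along a further dart of its face. -/
lemma exists_ne_face_eq [Finite V] (s : V → Bool) (d : G.Dart) (hd : s d.fst ≠ s d.snd) :
    ∃ e, e ≠ d ∧ R.face e = R.face d ∧ s e.fst ≠ s e.snd := by
  by_contra! hcon
  have hface : ∀ k : ℕ, R.face ((R.faceStep ^ k) d) = R.face d := by
    intro k
    rw [face_eq_iff]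
    exact Equiv.Perm.sameCycle_pow_left.2 (Equiv.Perm.SameCycle.refl _ _)
  have hper : ∃ k : ℕ, (R.faceStep ^ (k + 1)) d = d := by
    obtain ⟨n, hn, h⟩ := (isOfFinOrder_of_finite R.faceStep).exists_pow_eq_one
    exact ⟨n - 1, by rw [Nat.sub_add_cancel hn, h]; rfl⟩
  classical
  -- `Nat.find hper + 1` is the first return time to `d`, so no dart strictly in between is `d` and
  -- the colour cannot change back before the return.
  have key : ∀ k ≤ Nat.find hper, s ((R.faceStep ^ k) d).snd = s d.snd := by
    intro k
    induction k with
    | zero => simp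
    | succ k ih =>
      intro hk
      rw [← hcon _ (Nat.find_min hper hk) (hface _), pow_succ', Equiv.Perm.mul_apply,
        R.faceStep_fst]
      exact ih (by lia)
  apply hd
  rw [← key _ le_rfl, ← R.faceStep_fst, ← Equiv.Perm.mul_apply, ← pow_succ',
    Nat.find_spec hper]

namespace IsSimplicialCubic

variable (hR : R.IsSimplicialCubic)
include hR

lemma eq_const (s : V → Bool) (hs : ∀ d : G.Dart, s d.fst = s d.snd) (u v : V) : s u = s v := by
  obtain ⟨p⟩ := hR.connected.preconnected u v
  induction p with
  | nil => rfl
  | cons h p ih => exact (hs ⟨(_, _), h⟩).trans ih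

/-- The faces on the two sides of `d` and the face beyond `e` form a dual triangle. Being facial, it
surrounds an end of `d`, and dual simplicity identifies `e` as a dart at that end. -/
lemma eq_next_symm_or (d e : G.Dart) (he : R.face e = R.face d)
    (h : R.dual.Adj (R.face d.symm) (R.face e.symm)) :
    e = (R.next (R.next d)).symm ∨ e = R.next d.symm := by
  have h' : R.dual.Adj (R.face d) (R.face e.symm) := by
    rw [← he]
    exact hR.dual_adj_face e
  rcases hR.triangle_facial d _ h' h with h | h
  · left
    apply hR.dual_simple
    · rw [he, hR.face_next_next_symm]
    · rw [h, Dart.symm_symm]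
  · right
    apply hR.dual_simple
    · rw [he, R.face_next, Dart.symm_symm]
    · rw [h, R.face_next (R.next d.symm)]

/-- A cut with at most three edges separates at most a single vertex from the rest. -/
theorem exists_forall_ne_iff [Finite V] (s : V → Bool) (F : Set (Sym2 V)) (hF : F.ncard ≤ 3)
    (hs : ∀ d : G.Dart, s d.fst ≠ s d.snd → d.edge ∈ F) (d : G.Dart) (hd : s d.fst ≠ s d.snd) :
    F.ncard = 3 ∧ ∃ v, ∀ w, w ≠ v → s w ≠ s v := by
  have hsymm : ∀ e : G.Dart, s e.fst ≠ s e.snd → s e.symm.fst ≠ s e.symm.snd :=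
    fun e he ↦ he.symm
  -- Each of the two faces at `d` is left through a further cut edge. These are three different
  -- edges, so they exhaust `F`.
  obtain ⟨e, hed, hfe, hse⟩ := R.exists_ne_face_eq s d hd
  obtain ⟨f, hfd, hff, hsf⟩ := R.exists_ne_face_eq s d.symm (hsymm d hd)
  have n1 := hR.face_ne d
  have n2 := hR.face_ne e
  have n3 := hR.face_ne f
  have hfe' : f ≠ e.symm := by
    rintro rfl
    exact hed (hR.dual_simple _ _ hfe hff)
  have a1 : d.edge ≠ e.edge := by
    rw [Ne, dart_edge_eq_iff]
    rintro (rfl | rfl)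
    · exact hed rfl
    · exact n2 hfe
  have a2 : d.edge ≠ f.edge := by
    rw [Ne, dart_edge_eq_iff]
    rintro (rfl | rfl)
    · exact n1 hff
    · simp at hfd
  have a3 : e.edge ≠ f.edge := by
    rw [Ne, dart_edge_eq_iff]
    rintro (rfl | rfl)
    · exact n1 (hfe.symm.trans hff)
    · simp at hfe'
  have hcard : ({d.edge, e.edge, f.edge} : Set (Sym2 V)).ncard = 3 :=
    Set.ncard_eq_three.2 ⟨_, _, _, a1, a2, a3, rfl⟩
  have hFeq : F = {d.edge, e.edge, f.edge} := by
    refine (Set.eq_of_subset_of_ncard_le ?_ (by rw [hcard]; exact hF) (Set.toFinite _)).symm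
    rintro x (rfl | rfl | rfl)
    · exact hs _ hd
    · exact hs _ hse
    · exact hs _ hsf
  refine ⟨by rw [hFeq, hcard], ?_⟩
  have hcut : ∀ x : G.Dart, s x.fst ≠ s x.snd → x.edge = d.edge ∨ x.edge = e.edge ∨
      x.edge = f.edge := by
    intro x hx
    have := hs x hx
    rwa [hFeq] at this
  -- The face beyond `e` also needs a second cut edge, which can only be that of `f`. This closes
  -- the dual triangle.
  obtain ⟨g, hge, hfg, hsg⟩ := R.exists_ne_face_eq s e.symm (hsymm e hse)
  have hgf : g = f.symm := by
    have := hcut g hsg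
    simp only [dart_edge_eq_iff] at this
    rcases this with (rfl | rfl) | (rfl | rfl) | (rfl | rfl)
    · exact absurd (hfe.trans hfg) n2
    · exact absurd (hR.dual_simple _ _ hfe hfg.symm) hed
    · exact absurd hfg n2
    · exact absurd rfl hge
    · exact absurd (hR.dual_simple _ _ hfe (hfg.symm.trans hff)) hed
    · rfl
  subst hgf
  have hadj : R.dual.Adj (R.face d.symm) (R.face e.symm) := by
    rw [← hff, ← hfg]
    exact hR.dual_adj_face f
  obtain ⟨a, ha0, ha1, ha2, hx⟩ : ∃ a : G.Dart, s a.fst ≠ s a.snd ∧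
      s (R.next a).fst ≠ s (R.next a).snd ∧
      s (R.next (R.next a)).fst ≠ s (R.next (R.next a)).snd ∧
      ∀ x : G.Dart, s x.fst ≠ s x.snd → x.fst = a.fst ∨ x.snd = a.fst := by
    have hcut' : ∀ x : G.Dart, s x.fst ≠ s x.snd → (x = d ∨ x = d.symm) ∨ (x = e ∨ x = e.symm) ∨
        (x = f ∨ x = f.symm) := by
      simpa only [dart_edge_eq_iff] using hcut
    rcases hR.eq_next_symm_or d e hfe hadj with he | he
    · have hf : f = R.next d := by
        apply hR.dual_simple
        · rw [hff, R.face_next]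
        · rw [hfg, he, Dart.symm_symm, R.face_next (R.next d)]
      have he' : R.next (R.next d) = e.symm := by rw [he, Dart.symm_symm]
      refine ⟨d, hd, hf ▸ hsf, he' ▸ hsymm e hse, ?_⟩
      have hfst : f.fst = d.fst := by rw [hf, R.next_fst]
      have hsnd : e.snd = d.fst := by
        change e.symm.fst = _
        rw [← he', R.next_fst, R.next_fst]
      intro x hx
      rcases hcut' x hx with (rfl | rfl) | (rfl | rfl) | (rfl | rfl) <;> simp [hfst, hsnd]
    · have hf : f.symm = R.next (R.next d.symm) := by
        apply hR.dual_simple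
        · rw [hfg, he, R.face_next (R.next d.symm)]
        · rw [Dart.symm_symm, hff, hR.face_next_next_symm]
      refine ⟨d.symm, hsymm d hd, he ▸ hse, hf ▸ hsymm f hsf, ?_⟩
      have hfst : e.fst = d.snd := by rw [he, R.next_fst]; rfl
      have hsnd : f.snd = d.snd := by
        change f.symm.fst = _
        rw [hf, R.next_fst, R.next_fst]; rfl
      intro x hx
      rcases hcut' x hx with (rfl | rfl) | (rfl | rfl) | (rfl | rfl) <;> simp [hfst, hsnd]
  have hout : ∀ x : G.Dart, x.fst = a.fst → s x.fst ≠ s x.snd := by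
    intro x hxa
    rcases hR.eq_or_of_fst_eq hxa.symm with rfl | rfl | rfl
    · exact ha0
    · exact ha1
    · exact ha2
  classical
  -- The cut consists of exactly the three edges at `a.fst`, so flipping the colour of that vertex
  -- leaves a constant colouring.
  have hconst := hR.eq_const (fun w ↦ Bool.xor (s w) (decide (w = a.fst))) (fun x ↦ by
    have hne := x.fst_ne_snd
    by_cases h1 : x.fst = a.fst
    · have := hout x h1
      have h2 : x.snd ≠ a.fst := fun h ↦ hne (h1.trans h.symm)
      simp only [h1, h2, decide_true, decide_false] at this ⊢
      cases h : s x.snd <;> simp_all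
    · by_cases h2 : x.snd = a.fst
      · have := hout x.symm h2
        simp only [Dart.symm_toProd, Prod.fst_swap, Prod.snd_swap] at this
        simp only [h1, h2, decide_true, decide_false] at this ⊢
        cases h : s x.fst <;> simp_all
      · have : s x.fst = s x.snd := by
          by_contra h
          rcases hx x h with h | h
          · exact h1 h
          · exact h2 h
        simp [this, h1, h2])
  refine ⟨a.fst, fun w hw h ↦ ?_⟩
  have := hconst w a.fst
  simp [hw, h] at this

/-- Colour by membership in one component. With at most three deleted edges, `exists_forall_ne_iff`
isolates a single vertex as a component, which contains no cycle. -/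
theorem isCyclicallyFourEdgeConnected [Finite V] : IsCyclicallyFourEdgeConnected G := by
  refine ⟨hR.connected, fun F hF ↦ ?_⟩
  obtain ⟨-, hnc, hcyc⟩ := hF
  by_contra! hlt
  have := hR.connected.nonempty
  rw [connected_iff] at hnc
  obtain ⟨u, v, huv⟩ : ∃ u v, ¬ (G.deleteEdges F).Reachable u v := by
    by_contra! h
    exact hnc ⟨h, this⟩
  classical
  let s : V → Bool := fun w ↦ decide ((G.deleteEdges F).Reachable u w)
  have hs : ∀ d : G.Dart, s d.fst ≠ s d.snd → d.edge ∈ F := by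
    intro d hd
    by_contra hF
    have hadj : (G.deleteEdges F).Adj d.fst d.snd := deleteEdges_adj.2 ⟨d.adj, hF⟩
    apply hd
    simp only [s, decide_eq_decide]
    exact ⟨fun h ↦ h.trans hadj.reachable, fun h ↦ h.trans hadj.symm.reachable⟩
  obtain ⟨d, hd⟩ : ∃ d : G.Dart, s d.fst ≠ s d.snd := by
    by_contra! h
    have := hR.eq_const s h u v
    simp [s, huv] at this
  obtain ⟨-, x, hx⟩ := hR.exists_forall_ne_iff s F (by lia) hs d hd
  have hsing : ∀ w, (G.deleteEdges F).Reachable x w → w = x := by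
    intro w hw
    by_contra hne
    apply hx w hne
    simp only [s, decide_eq_decide]
    exact ⟨fun h ↦ h.trans hw.symm, fun h ↦ h.trans hw⟩
  obtain ⟨y, hy, c, hc⟩ := hcyc ((G.deleteEdges F).connectedComponentMk x)
  have hyx : y = x := hsing y (ConnectedComponent.exact hy).symm
  subst hyx
  have hadj := c.adj_snd hc.not_nil
  exact hadj.ne (hsing _ hadj.reachable).symm

/-- A two-colouring can be changed at one vertex of a cubic graph so that at most one edge at this
vertex has ends of different colours. -/
lemma exists_update (s : V → Bool) (a : V) [DecidableEq V] :
    ∃ c, ∃ e : G.Dart, ∀ d : G.Dart, d.fst = a →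
      Function.update s a c d.fst ≠ Function.update s a c d.snd → d = e := by
  obtain ⟨d, rfl⟩ := hR.exists_dart a
  -- The new colour is the majority colour of the three neighbours.
  have key : ∀ p q r : Bool, ∃ c, (c = p ∧ c = q) ∨ (c = p ∧ c = r) ∨ (c = q ∧ c = r) := by decide
  obtain ⟨c, hc⟩ := key (s d.snd) (s (R.next d).snd) (s (R.next (R.next d)).snd)
  have hval : ∀ x : G.Dart, x.fst = d.fst → Function.update s d.fst c x.fst ≠
      Function.update s d.fst c x.snd → c ≠ s x.snd := by
    intro x hx h
    have hne : x.snd ≠ d.fst := fun h ↦ x.fst_ne_snd (hx.trans h.symm)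
    rwa [Function.update_of_ne hne, hx, Function.update_self] at h
  have h3 : ∀ x : G.Dart, x.fst = d.fst → x = d ∨ x = R.next d ∨ x = R.next (R.next d) :=
    fun x hx ↦ hR.eq_or_of_fst_eq hx.symm
  rcases hc with ⟨h1, h2⟩ | ⟨h1, h2⟩ | ⟨h1, h2⟩
  · refine ⟨c, R.next (R.next d), fun x hx h ↦ ?_⟩
    have := hval x hx h
    rcases h3 x hx with rfl | rfl | rfl <;> simp_all
  · refine ⟨c, R.next d, fun x hx h ↦ ?_⟩
    have := hval x hx h
    rcases h3 x hx with rfl | rfl | rfl <;> simp_all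
  · refine ⟨c, d, fun x hx h ↦ ?_⟩
    have := hval x hx h
    rcases h3 x hx with rfl | rfl | rfl <;> simp_all

/-- This converts vertex cuts into edge cuts: recolouring the vertices of `T` one at a time by
majority costs at most one bichromatic edge each, and edges away from the recoloured vertex are
unaffected. -/
lemma exists_recolouring [DecidableEq V] (s₀ : V → Bool) (T : Finset V) :
    ∃ s : V → Bool, (∀ v ∉ T, s v = s₀ v) ∧ ∃ F : Finset (Sym2 V), F.card ≤ T.card ∧
      ∀ d : G.Dart, s d.fst ≠ s d.snd → d.edge ∈ F ∨ (d.fst ∉ T ∧ d.snd ∉ T) := by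
  induction T using Finset.induction_on with
  | empty => exact ⟨s₀, by simp, ∅, by simp⟩
  | insert a T ha ih =>
    obtain ⟨s, hs, F, hF, hcut⟩ := ih
    obtain ⟨c, e, he⟩ := hR.exists_update s a
    refine ⟨Function.update s a c, ?_, insert e.edge F, ?_, ?_⟩
    · intro v hv
      simp only [Finset.mem_insert, not_or] at hv
      rw [Function.update_of_ne hv.1, hs v hv.2]
    · rw [Finset.card_insert_of_notMem ha]
      exact (Finset.card_insert_le _ _).trans (by lia)
    · intro d hd
      by_cases h1 : d.fst = a
      · simp [he d h1 hd]
      · by_cases h2 : d.snd = a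
        · have := he d.symm h2 (Ne.symm hd)
          rw [← d.edge_symm, this]
          simp
        · rw [Function.update_of_ne h1, Function.update_of_ne h2] at hd
          have := hcut d hd
          simp [h1, h2]
          tauto

/-- Two separating vertices would give, after recolouring them, a nonconstant colouring with at most
two bichromatic edges, whereas every cut with at most three edges has exactly three. -/
theorem isThreeConnected [Finite V] (hV : 3 < Nat.card V) : IsThreeConnected G := by
  classical
  refine ⟨hV, fun S hS ↦ ?_⟩
  have hne : Nonempty (Sᶜ : Set V) := by
    rw [← not_isEmpty_iff, Set.isEmpty_coe_sort, Set.compl_empty_iff]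
    rintro rfl
    rw [Set.ncard_univ] at hS
    lia
  rw [connected_iff]
  refine ⟨?_, hne⟩
  by_contra hpre
  obtain ⟨u, v, huv⟩ : ∃ u v, ¬ (G.induce Sᶜ).Reachable u v := by
    by_contra! h
    exact hpre h
  let s₀ : V → Bool := fun w ↦ decide (∃ h : w ∈ Sᶜ, (G.induce Sᶜ).Reachable u ⟨w, h⟩)
  have hfin := S.toFinite
  obtain ⟨s, hs, F, hF, hcut⟩ := hR.exists_recolouring s₀ hfin.toFinset
  simp only [Set.Finite.mem_toFinset] at hs hcut
  rw [← Set.ncard_eq_toFinset_card] at hF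
  have hsF : ∀ d : G.Dart, s d.fst ≠ s d.snd → d.edge ∈ (F : Set (Sym2 V)) := by
    intro d hd
    rcases hcut d hd with h | ⟨h1, h2⟩
    · exact h
    · exfalso
      rw [hs _ h1, hs _ h2] at hd
      apply hd
      have hadj : (G.induce Sᶜ).Adj ⟨d.fst, h1⟩ ⟨d.snd, h2⟩ := d.adj
      simp only [s₀, decide_eq_decide]
      exact ⟨fun ⟨_, h⟩ ↦ ⟨h2, h.trans hadj.reachable⟩,
        fun ⟨_, h⟩ ↦ ⟨h1, h.trans hadj.symm.reachable⟩⟩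
  obtain ⟨d, hd⟩ : ∃ d : G.Dart, s d.fst ≠ s d.snd := by
    by_contra! h
    have := hR.eq_const s h u v
    rw [hs _ u.2, hs _ v.2] at this
    have hu : s₀ u = true := decide_eq_true ⟨u.2, Reachable.refl _⟩
    have hv : s₀ v = false := decide_eq_false fun ⟨_, h⟩ ↦ huv h
    simp [hu, hv] at this
  have := (hR.exists_forall_ne_iff s F (by rw [Set.ncard_coe_finset]; lia) hsF d hd).1
  rw [Set.ncard_coe_finset] at this
  lia

theorem isCubic [Finite V] : IsCubic G := by
  intro v
  classical
  obtain ⟨d, rfl⟩ := hR.exists_dart v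
  have hset : G.neighborSet d.fst = {d.snd, (R.next d).snd, (R.next (R.next d)).snd} := by
    ext w
    simp only [mem_neighborSet, Set.mem_insert_iff, Set.mem_singleton_iff]
    constructor
    · intro h
      rcases hR.eq_or_of_fst_eq (d := d) (e := ⟨(d.fst, w), h⟩) rfl with h | h | h
      · left; rw [← h]
      · right; left; rw [← h]
      · right; right; rw [← h]
    · rintro (rfl | rfl | rfl)
      · exact d.adj
      · have := (R.next d).adj
        rwa [R.next_fst] at this
      · have := (R.next (R.next d)).adj
        rwa [R.next_fst, R.next_fst] at this
  have hext : ∀ x y : G.Dart, x.fst = y.fst → x.snd = y.snd → x = y :=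
    fun x y h1 h2 ↦ Dart.ext _ _ (Prod.ext h1 h2)
  rw [hset]
  refine Set.ncard_eq_three.2 ⟨_, _, _, ?_, ?_, ?_, rfl⟩
  · exact fun h ↦ hR.next_ne d (hext _ _ (R.next_fst d) h.symm)
  · exact fun h ↦ hR.next_next_ne d (hext _ _ (by simp [R.next_fst]) h.symm)
  · exact fun h ↦ hR.next_ne (R.next d) (hext _ _ (by simp [R.next_fst]) h.symm)

end IsSimplicialCubic
end RotationSystem
end PlanarPartition

/-! ### Hamiltonian cycles and forest partitions violate the criterion. -/

namespace PlanarPartition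

open SimpleGraph

namespace RotationSystem.IsSimplicialCubic

variable {V : Type*} {G : SimpleGraph V} {R : RotationSystem G} (hR : R.IsSimplicialCubic)
include hR

lemma face_eq_const (c : R.Face → Bool) (hc : ∀ d, c (R.face d) = c (R.face d.symm))
    (f g : R.Face) : c f = c g := by
  obtain ⟨d, rfl⟩ := R.face_surjective f
  obtain ⟨e, rfl⟩ := R.face_surjective g
  choose b hb using hR.exists_dart
  have hn : ∀ d, c (R.face (R.next d)) = c (R.face d) := fun d ↦ by rw [hc d, R.face_next]
  have hv : ∀ d e, d.fst = e.fst → c (R.face d) = c (R.face e) := by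
    intro d e h
    rcases hR.eq_or_of_fst_eq h with rfl | rfl | rfl <;> simp [hn]
  have := hR.eq_const (fun v ↦ c (R.face (b v))) (fun d ↦ by
    rw [hv (b d.fst) d (hb _), hc d]
    exact hv _ _ (hb _).symm) d.fst e.fst
  rwa [hv _ d (hb _), hv _ e (hb _)] at this

/-- A face colouring that changes only along a connected `2`-factor changes along all of it or
nowhere. -/
lemma forall_ne_or_forall_eq (C : G.Dart → Prop) (hsymm : ∀ d, C d → C d.symm)
    (hC : ∀ v, ∃ a : G.Dart, a.fst = v ∧ ¬ C a ∧ C (R.next a) ∧ C (R.next (R.next a)))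
    (hconn : ∀ s : V → Bool, (∀ d : G.Dart, C d → s d.fst = s d.snd) → ∀ u v, s u = s v)
    (c : R.Face → Bool) (hc : ∀ d, ¬ C d → c (R.face d) = c (R.face d.symm)) :
    (∀ d, C d → c (R.face d) ≠ c (R.face d.symm)) ∨ ∀ f g, c f = c g := by
  choose a ha0 ha1 ha2 ha3 using hC
  -- Since `c` does not change across the third edge `a v`, it changes across both edges of `C` at
  -- `v` or across neither. Hence `s` is constant along `C`.
  let s : V → Bool := fun v ↦ c (R.face (R.next (a v))) == c (R.face (R.next (R.next (a v))))
  have hs : ∀ d, C d → s d.fst = (c (R.face d) == c (R.face d.symm)) := by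
    intro d hd
    have h0 := hc _ (ha1 d.fst)
    rw [← R.face_next] at h0
    rcases hR.eq_or_of_fst_eq (ha0 d.fst) with h | h | h
    · rw [h] at hd
      exact absurd hd (ha1 _)
    · rw [← R.face_next d]
      simp only [s]
      rw [← h]
    · rw [← R.face_next d]
      simp only [s]
      rw [(congrArg R.next h).trans (hR.next_three _), h0, Bool.beq_comm, ← h]
  have hs' := hconn s (fun d hd ↦ by
    rw [hs d hd]
    have := hs _ (hsymm d hd)
    rw [Dart.symm_symm] at this
    rw [Bool.beq_comm, ← this]; rfl)
  obtain ⟨v⟩ := hR.connected.nonempty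
  cases hv : s v
  · left
    intro d hd h
    have := hs d hd
    rw [hs' _ v, hv, h] at this
    simp at this
  · right
    apply hR.face_eq_const
    intro d
    by_cases hd : C d
    · have := hs d hd
      rw [hs' _ v, hv] at this
      exact beq_iff_eq.1 this.symm
    · exact hc d hd

/-- The faces on one side of a connected `2`-factor are connected in the dual. -/
lemma preconnected_side (C : G.Dart → Prop) (hsymm : ∀ d, C d → C d.symm)
    (hC : ∀ v, ∃ a : G.Dart, a.fst = v ∧ ¬ C a ∧ C (R.next a) ∧ C (R.next (R.next a)))
    (hconn : ∀ s : V → Bool, (∀ d : G.Dart, C d → s d.fst = s d.snd) → ∀ u v, s u = s v)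
    (S : Set R.Face) (hS : ∀ d, C d → (R.face d ∈ S ↔ R.face d.symm ∉ S))
    (hS' : ∀ d, ¬ C d → (R.face d ∈ S ↔ R.face d.symm ∈ S)) :
    (R.dual.induce S).Preconnected := by
  classical
  intro x y
  by_contra hxy
  let c : R.Face → Bool := fun f ↦ decide (∃ h : f ∈ S, (R.dual.induce S).Reachable x ⟨f, h⟩)
  have hx : c x.1 = true := decide_eq_true ⟨x.2, Reachable.refl _⟩
  have hy : c y.1 = false := decide_eq_false fun ⟨_, h⟩ ↦ hxy h
  have hcS : ∀ f ∉ S, c f = false := fun f hf ↦ decide_eq_false fun ⟨h, _⟩ ↦ hf h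
  rcases hR.forall_ne_or_forall_eq C hsymm hC hconn c (fun d hd ↦ by
    by_cases h : R.face d ∈ S
    · have h' := (hS' d hd).1 h
      have hadj : (R.dual.induce S).Adj ⟨_, h⟩ ⟨_, h'⟩ := hR.dual_adj_face d
      simp only [c, decide_eq_decide]
      exact ⟨fun ⟨_, h⟩ ↦ ⟨h', h.trans hadj.reachable⟩,
        fun ⟨_, h'⟩ ↦ ⟨h, h'.trans hadj.symm.reachable⟩⟩
    · rw [hcS _ h, hcS _ (fun h' ↦ h ((hS' d hd).2 h'))]) with h | h
  -- If a dart of the face is not in `C`, the next one is, because only one edge at their common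
  -- vertex is outside `C`. Across this dart of `C`, `c` is false on both sides.
  · obtain ⟨d, hd, hdy⟩ : ∃ d, C d ∧ R.face d = y.1 := by
      obtain ⟨d, hd⟩ := R.face_surjective y.1
      by_cases hCd : C d
      · exact ⟨d, hCd, hd⟩
      · refine ⟨R.faceStep d, ?_, by rw [R.face_faceStep, hd]⟩
        rw [R.faceStep_apply]
        obtain ⟨a, ha, h0, h1, h2⟩ := hC d.symm.fst
        rcases hR.eq_or_of_fst_eq ha with h | h | h
        · rw [h]; exact h1
        · rw [h]; exact h2
        · exact absurd (hsymm d.symm (h ▸ h2)) (by rwa [Dart.symm_symm])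
    apply h d hd
    rw [hdy, hy, hcS _ ((hS d hd).1 (hdy ▸ y.2))]
  · have := h x.1 y.1
    rw [hx, hy] at this
    exact Bool.noConfusion this

/-- A combinatorial Jordan curve argument. The dual edges not crossing `C` number `V / 2`, too few
to connect `V / 2 + 2` faces, so some face colouring is constant across them without being constant.
It then changes along all of `C`, and its two classes are the sides of `C`. -/
theorem not_exists_connected_two_factor [Finite V] (hV : Nat.card V % 3 ≠ 2) (f₀ : R.Face)
    (hf₀ : ∀ f ≠ f₀, Nat.card {d : G.Dart // R.face d = f} % 3 = 2)
    (C : G.Dart → Prop) (hsymm : ∀ d, C d → C d.symm)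
    (hC : ∀ v, ∃ a : G.Dart, a.fst = v ∧ ¬ C a ∧ C (R.next a) ∧ C (R.next (R.next a)))
    (hconn : ∀ s : V → Bool, (∀ d : G.Dart, C d → s d.fst = s d.snd) → ∀ u v, s u = s v) :
    False := by
  classical
  have := Fintype.ofFinite R.Face
  let M : SimpleGraph R.Face :=
    { Adj := fun f g ↦ ∃ d, ¬ C d ∧ R.face d = f ∧ R.face d.symm = g
      symm := ⟨fun f g ⟨d, hd, h1, h2⟩ ↦
        ⟨d.symm, fun h ↦ hd (d.symm_symm ▸ hsymm _ h), h2, by rwa [Dart.symm_symm]⟩⟩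
      loopless := ⟨fun f ⟨d, _, h1, h2⟩ ↦ hR.face_ne d (h1.trans h2.symm)⟩ }
  have hcard : 2 * Nat.card M.edgeSet = Nat.card V := by
    rw [Nat.card_eq_fintype_card, card_edgeSet, ← dart_card_eq_twice_card_edges,
      ← Nat.card_eq_fintype_card]
    have e1 : {d : G.Dart // ¬ C d} ≃ M.Dart := Equiv.ofBijective
      (fun d ↦ ⟨(R.face d.1, R.face d.1.symm), d.1, d.2, rfl, rfl⟩) ⟨by
        rintro ⟨d, hd⟩ ⟨e, he⟩ h
        exact Subtype.ext (hR.dual_simple d e (congrArg (fun x : M.Dart ↦ x.fst) h)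
          (congrArg (fun x : M.Dart ↦ x.snd) h)), by
        rintro ⟨⟨f, g⟩, d, hd, h1, h2⟩
        exact ⟨⟨d, hd⟩, Dart.ext _ _ (Prod.ext h1 h2)⟩⟩
    have e2 : {d : G.Dart // ¬ C d} ≃ V := Equiv.ofBijective (fun d ↦ d.1.fst) ⟨by
        rintro ⟨d, hd⟩ ⟨e, he⟩ h
        obtain ⟨a, ha, h0, h1, h2⟩ := hC d.fst
        have key : ∀ x : G.Dart, ¬ C x → x.fst = d.fst → x = a := by
          intro x hx hxd
          rcases hR.eq_or_of_fst_eq (ha.trans hxd.symm) with rfl | rfl | rfl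
          · rfl
          · exact absurd h1 hx
          · exact absurd h2 hx
        exact Subtype.ext ((key d hd rfl).trans (key e he h.symm).symm), by
        intro v
        obtain ⟨a, ha, h0, -⟩ := hC v
        exact ⟨⟨a, h0⟩, ha⟩⟩
    rw [← Nat.card_congr e1, Nat.card_congr e2]
  have hM : ¬ M.Connected := by
    intro h
    have h1 := h.card_vert_le_card_edgeSet_add_one
    have h2 := hR.card
    lia
  obtain ⟨v⟩ := hR.connected.nonempty
  obtain ⟨d₀, -⟩ := hR.exists_dart v
  rw [connected_iff] at hM
  obtain ⟨f, g, hfg⟩ : ∃ f g, ¬ M.Reachable f g := by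
    by_contra! h
    exact hM ⟨h, ⟨R.face d₀⟩⟩
  let c : R.Face → Bool := fun h ↦ decide (M.Reachable f h)
  have hc : ∀ d, ¬ C d → c (R.face d) = c (R.face d.symm) := by
    intro d hd
    have hadj : M.Adj (R.face d) (R.face d.symm) := ⟨d, hd, rfl, rfl⟩
    simp only [c, decide_eq_decide]
    exact ⟨fun h ↦ h.trans hadj.reachable, fun h ↦ h.trans hadj.symm.reachable⟩
  have hne := (hR.forall_ne_or_forall_eq C hsymm hC hconn c hc).resolve_right (fun h ↦ by
    have := h f g
    simp [c, hfg] at this)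
  let S : Set R.Face := {h | c h = true}
  have hCS : ∀ d, C d → (R.face d ∈ S ↔ R.face d.symm ∉ S) := by
    intro d hd
    have := hne d hd
    simp only [S, Set.mem_ofPred_eq]
    cases h1 : c (R.face d) <;> cases h2 : c (R.face d.symm) <;> simp_all
  have hCS' : ∀ d, ¬ C d → (R.face d ∈ S ↔ R.face d.symm ∈ S) := by
    intro d hd
    simp only [S, Set.mem_ofPred_eq, hc d hd]
  have hbi : ∀ d, ¬ ((R.face d ∈ S ↔ R.face (R.next d) ∈ S) ∧
      (R.face (R.next d) ∈ S ↔ R.face (R.next (R.next d)) ∈ S)) := by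
    rintro d ⟨h1, h2⟩
    obtain ⟨a, ha, h0, hc1, hc2⟩ := hC d.fst
    have : C d ∨ C (R.next d) := by
      rcases hR.eq_or_of_fst_eq ha with rfl | rfl | rfl
      · exact Or.inr hc1
      · exact Or.inl hc1
      · exact Or.inl hc2
    rcases this with h | h
    · have := hCS d h
      rw [← R.face_next, ← h1] at this
      tauto
    · have := hCS _ h
      rw [← R.face_next, ← h2] at this
      tauto
  have hle : ∀ T : Set R.Face, (R.dual.induce T).Preconnected →
      Nat.card T ≤ Nat.card (R.dual.induce T).edgeSet + 1 := by
    intro T hT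
    rcases isEmpty_or_nonempty T with h | h
    · simp
    · exact Connected.card_vert_le_card_edgeSet_add_one ⟨hT⟩
  refine hR.grinberg hV f₀ hf₀ S (fun d h ↦ hbi d (by tauto)) (fun d h ↦ hbi d (by tauto))
    (Or.inr ⟨hle _ ?_, hle _ ?_⟩)
  · exact hR.preconnected_side C hsymm hC hconn S hCS hCS'
  · refine hR.preconnected_side C hsymm hC hconn Sᶜ (fun d hd ↦ ?_) (fun d hd ↦ ?_)
    · have := hCS d hd
      simp only [Set.mem_compl_iff]
      tauto
    · have := hCS' d hd
      simp only [Set.mem_compl_iff]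
      tauto

theorem not_isHamiltonian [Fintype V] [DecidableEq V] [Nontrivial V] (hV : Nat.card V % 3 ≠ 2)
    (f₀ : R.Face) (hf₀ : ∀ f ≠ f₀, Nat.card {d : G.Dart // R.face d = f} % 3 = 2) :
    ¬ G.IsHamiltonian := by
  intro hG
  obtain ⟨v₀⟩ := hR.connected.nonempty
  obtain ⟨p, hp⟩ := hG.exists_isHamiltonianCycle v₀
  refine hR.not_exists_connected_two_factor hV f₀ hf₀ (fun d ↦ p.toSubgraph.Adj d.fst d.snd)
    (fun d hd ↦ hd.symm) ?_ ?_
  · intro v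
    obtain ⟨d, rfl⟩ := hR.exists_dart v
    have h2 := hp.isCycle.ncard_neighborSet_toSubgraph_eq_two (hp.mem_support d.fst)
    have hsub : ∀ w, p.toSubgraph.Adj d.fst w → w = d.snd ∨ w = (R.next d).snd ∨
        w = (R.next (R.next d)).snd := by
      intro w hw
      rcases hR.eq_or_of_fst_eq (d := d) (e := ⟨(d.fst, w), hw.adj_sub⟩) rfl with h | h | h
      · left; rw [← h]
      · right; left; rw [← h]
      · right; right; rw [← h]
    -- With `hthree` this leaves exactly two of the three darts on the cycle; the remaining one
    -- serves as `a`.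
    have hone : ∀ x, ¬ p.toSubgraph.neighborSet d.fst ⊆ {x} := by
      intro x h
      have := Set.ncard_le_ncard h
      rw [h2, Set.ncard_singleton] at this
      lia
    have hthree : ¬ (p.toSubgraph.Adj d.fst d.snd ∧ p.toSubgraph.Adj d.fst (R.next d).snd ∧
        p.toSubgraph.Adj d.fst (R.next (R.next d)).snd) := by
      rintro ⟨a, b, c⟩
      have : p.toSubgraph.neighborSet d.fst = G.neighborSet d.fst := by
        apply Set.Subset.antisymm (fun w hw ↦ hw.adj_sub)
        intro w hw
        rcases hR.eq_or_of_fst_eq (d := d) (e := ⟨(d.fst, w), hw⟩) rfl with h | h | h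
        · have : w = d.snd := by rw [← h]
          rw [this]; exact a
        · have : w = (R.next d).snd := by rw [← h]
          rw [this]; exact b
        · have : w = (R.next (R.next d)).snd := by rw [← h]
          rw [this]; exact c
      rw [this, hR.isCubic] at h2
      lia
    have f1 := R.next_fst d
    have f2 := R.next_fst (R.next d)
    have f3 := hR.next_three d
    by_cases a : p.toSubgraph.Adj d.fst d.snd <;>
      by_cases b : p.toSubgraph.Adj d.fst (R.next d).snd <;>
      by_cases c : p.toSubgraph.Adj d.fst (R.next (R.next d)).snd
    · exact absurd ⟨a, b, c⟩ hthree
    · exact ⟨R.next (R.next d), by simp_all⟩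
    · exact ⟨R.next d, by simp_all⟩
    · refine absurd (fun w hw ↦ ?_) (hone d.snd)
      rcases hsub w hw with rfl | rfl | rfl <;> first | rfl | contradiction
    · exact ⟨d, by simp_all⟩
    · refine absurd (fun w hw ↦ ?_) (hone (R.next d).snd)
      rcases hsub w hw with rfl | rfl | rfl <;> first | rfl | contradiction
    · refine absurd (fun w hw ↦ ?_) (hone (R.next (R.next d)).snd)
      rcases hsub w hw with rfl | rfl | rfl <;> first | rfl | contradiction
    · refine absurd (fun w hw ↦ ?_) (hone d.snd)
      rcases hsub w hw with rfl | rfl | rfl <;> first | rfl | contradiction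
  · intro s hs u v
    have hmem : ∀ w, w ∈ p.toSubgraph.verts := fun w ↦
      p.mem_verts_toSubgraph.2 (hp.mem_support w)
    obtain ⟨q⟩ := p.toSubgraph_connected.coe.preconnected ⟨u, hmem u⟩ ⟨v, hmem v⟩
    have key : ∀ x y : p.toSubgraph.verts, p.toSubgraph.coe.Walk x y → s x = s y := by
      intro x y q
      induction q with
      | nil => rfl
      | cons h q ih => exact (hs ⟨(_, _), h.adj_sub⟩ h).trans ih
    exact key _ _ q

theorem not_hasForestTriangleForestPartition [Finite V] (hV : Nat.card V % 3 ≠ 2) (f₀ : R.Face)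
    (hf₀ : ∀ f ≠ f₀, Nat.card {d : G.Dart // R.face d = f} % 3 = 2) :
    ¬ HasForestTriangleForestPartition R.octahedralStackedDual := by
  rintro ⟨A, hA, hB⟩
  classical
  have htri : ∀ x y z, x ∈ A → y ∈ A → z ∈ A → R.octahedralStackedDual.Adj x y →
      R.octahedralStackedDual.Adj x z → R.octahedralStackedDual.Adj y z → False := by
    intro x y z hx hy hz hxy hxz hyz
    have h1 : (R.octahedralStackedDual.induce A).Adj ⟨x, hx⟩ ⟨y, hy⟩ := hxy
    have h2 : (R.octahedralStackedDual.induce A).Adj ⟨x, hx⟩ ⟨z, hz⟩ := hxz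
    have h3 : (R.octahedralStackedDual.induce A).Adj ⟨y, hy⟩ ⟨z, hz⟩ := hyz
    exact hA.cliqueFree le_rfl _ (is3Clique_triple_iff.2 ⟨h1, h2, h3⟩)
  have hquad : ∀ w x y z, w ∉ A → x ∉ A → y ∉ A → z ∉ A → w ≠ y → x ≠ z →
      R.octahedralStackedDual.Adj w x → R.octahedralStackedDual.Adj x y →
      R.octahedralStackedDual.Adj y z → R.octahedralStackedDual.Adj z w → False := by
    intro w x y z hw hx hy hz hwy hxz hwx hxy hyz hzw
    have h1 : (R.octahedralStackedDual.induce Aᶜ).Adj ⟨w, hw⟩ ⟨x, hx⟩ := hwx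
    have h2 : (R.octahedralStackedDual.induce Aᶜ).Adj ⟨x, hx⟩ ⟨y, hy⟩ := hxy
    have h3 : (R.octahedralStackedDual.induce Aᶜ).Adj ⟨y, hy⟩ ⟨z, hz⟩ := hyz
    have h4 : (R.octahedralStackedDual.induce Aᶜ).Adj ⟨z, hz⟩ ⟨w, hw⟩ := hzw
    refine hB _ (.cons h1 (.cons h2 (.cons h3 (.cons h4 .nil)))) ?_ (by simp)
    have n1 := hwx.ne
    have n2 := hxy.ne
    have n3 := hyz.ne
    have n4 := hzw.ne
    simp only [Walk.isCycle_def, Walk.isTrail_def]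
    simp [n1, n2, n3, n4, n1.symm, n4.symm, hwy, hxz, hwy.symm]
  let S : Set R.Face := {f | Sum.inl f ∈ A}
  have hdual : ∀ d, R.dual.Adj (R.face d) (R.face (R.next d)) := fun d ↦ by
    rw [R.face_next]
    exact hR.dual_adj_face d
  have hS1 : ∀ d, ¬ (R.face d ∈ S ∧ R.face (R.next d) ∈ S ∧ R.face (R.next (R.next d)) ∈ S) := by
    rintro d ⟨h0, h1, h2⟩
    refine htri _ _ _ h0 h1 h2 (hdual d) ?_ (hdual _)
    have := hdual (R.next (R.next d))
    rw [hR.next_three] at this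
    exact this.symm
  have hS2 : ∀ d, ¬ (R.face d ∉ S ∧ R.face (R.next d) ∉ S ∧ R.face (R.next (R.next d)) ∉ S) := by
    have key : ∀ d, R.face d ∉ S → R.face (R.next d) ∉ S → R.face (R.next (R.next d)) ∉ S →
        Sum.inr d ∈ A := by
      intro d h0 h1 h2
      by_contra hd
      have h3 := hdual (R.next (R.next d))
      rw [hR.next_three] at h3
      -- The new vertex `d` is joined to two corners of its triangle, and the third corner completes
      -- the 4-cycle.
      refine hquad (.inr d) (.inl (R.face d)) (.inl (R.face (R.next (R.next d))))
        (.inl (R.face (R.next d))) hd h0 h2 h1 (by simp) ?_ ?_ h3.symm (hdual _).symm ?_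
      · simpa using (hdual d).ne
      · exact Or.inl rfl
      · exact Or.inr (R.face_next d)
    rintro d ⟨h0, h1, h2⟩
    have n3 := hR.next_three d
    refine htri (.inr d) (.inr (R.next d)) (.inr (R.next (R.next d))) (key d h0 h1 h2)
      (key _ h1 h2 (by rwa [n3])) (key _ h2 (by rwa [n3]) (by rwa [n3])) ?_ ?_ ?_
    · exact ⟨(hR.next_ne d).symm, (R.next_fst d).symm⟩
    · exact ⟨(hR.next_next_ne d).symm, by simp [R.next_fst]⟩
    · exact ⟨(hR.next_ne _).symm, by simp [R.next_fst]⟩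
  have hacA : (R.dual.induce S).IsAcyclic :=
    hA.comap ⟨fun f ↦ ⟨.inl f.1, f.2⟩, fun h ↦ h⟩
      (fun f g h ↦ Subtype.ext (Sum.inl_injective (congrArg Subtype.val h)))
  have hacB : (R.dual.induce Sᶜ).IsAcyclic := by
    intro v c hc
    let φ : R.dual.induce Sᶜ →g R.octahedralStackedDual.induce Aᶜ :=
      ⟨fun f ↦ ⟨.inl f.1, f.2⟩, fun h ↦ h⟩
    have hφ : Function.Injective φ :=
      fun f g h ↦ Subtype.ext (Sum.inl_injective (congrArg Subtype.val h))
    have hlen := hB _ (c.map φ) (hc.map hφ)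
    rw [Walk.length_map] at hlen
    -- Only triangles remain; they are facial in the dual, and `hS2` excludes facial triangles
    -- outside `S`.
    have h3 : c.length = 3 := le_antisymm (by lia) hc.three_le_length
    obtain ⟨s, hs⟩ := is3Clique_iff_exists_cycle_length_three.2 ⟨v, c, hc, h3⟩
    obtain ⟨x, y, z, hxy, hxz, hyz, -⟩ := is3Clique_iff.1 hs
    obtain ⟨-, d, hdx, hdy⟩ := hxy
    replace hdx : R.face d = x.1 := hdx
    replace hdy : R.face d.symm = y.1 := hdy
    have hx : R.face d ∉ S := hdx ▸ x.2
    have hy : R.face d.symm ∉ S := hdy ▸ y.2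
    rcases hR.triangle_facial d z.1 (hdx ▸ hxz) (hdy ▸ hyz) with h | h
    · exact hS2 d ⟨hx, by rwa [R.face_next], h ▸ z.2⟩
    · exact hS2 d.symm ⟨hy, by rwa [R.face_next, Dart.symm_symm], h ▸ z.2⟩
  have hle : ∀ T : Set R.Face, T.Nonempty → (R.dual.induce T).IsAcyclic →
      Nat.card (R.dual.induce T).edgeSet + 1 ≤ Nat.card T := by
    intro T hT hac
    have := hT.to_subtype
    -- A forest on `T` extends to a spanning tree of the complete graph, which bounds its number of
    -- edges.
    obtain ⟨F, hF, -, hFt⟩ :=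
      (connected_top (V := T)).exists_isTree_le_of_le_of_isAcyclic le_top hac
    rw [← (isTree_iff_connected_and_card.1 hFt).2]
    exact Nat.add_le_add_right (Nat.card_mono (Set.toFinite _) (edgeSet_mono hF)) 1
  obtain ⟨v⟩ := hR.connected.nonempty
  obtain ⟨d, -⟩ := hR.exists_dart v
  have hne : S.Nonempty := by
    by_contra h
    rw [Set.not_nonempty_iff_eq_empty] at h
    exact hS2 d (by simp [h])
  have hne' : Sᶜ.Nonempty := by
    by_contra h
    rw [Set.not_nonempty_iff_eq_empty, Set.compl_empty_iff] at h
    exact hS1 d (by simp [h])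
  exact hR.grinberg hV f₀ hf₀ S hS1 hS2 (Or.inl ⟨hle S hne hacA, hle _ hne' hacB⟩)

end RotationSystem.IsSimplicialCubic
end PlanarPartition

/-! ### Planarity of the stacked dual. -/

namespace PlanarPartition

open SimpleGraph

namespace RotationSystem

variable {V : Type*} {G : SimpleGraph V} (R : RotationSystem G)

omit R in
lemma rel_of_sameCycle {α : Type*} [Finite α] {f : Equiv.Perm α} {r : α → α → Prop}
    (hrefl : ∀ x, r x x) (htrans : ∀ x y z, r x y → r y z → r x z) (h : ∀ x, r x (f x)) {x y : α}
    (hxy : f.SameCycle x y) : r x y := by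
  obtain ⟨i, rfl⟩ := hxy.exists_nat_pow_eq
  induction i with
  | zero => exact hrefl x
  | succ i ih =>
    rw [pow_succ', Equiv.Perm.mul_apply]
    exact htrans _ _ _ (ih ⟨i, rfl⟩) (h _)

/-- Faces are classified by a labelling of the darts that is constant along face tracing and has a
representative for each label in each face with that label. -/
lemma exists_face_equiv [Finite V] {L : Type*} (label : G.Dart → L) (rep : L → G.Dart)
    (hlabel : ∀ d, label (R.faceStep d) = label d) (hrep : ∀ l, label (rep l) = l)
    (h : ∀ d, R.faceStep.SameCycle (rep (label d)) d) :
    ∃ e : R.Face ≃ L, ∀ d, e (R.face d) = label d := by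
  have hconst : ∀ d e, R.faceStep.SameCycle d e → label d = label e := fun d e ↦
    rel_of_sameCycle (r := fun d e ↦ label d = label e) (fun _ ↦ rfl)
      (fun _ _ _ h h' ↦ h.trans h') (fun d ↦ (hlabel d).symm)
  refine ⟨⟨Quotient.lift label hconst, fun l ↦ R.face (rep l), ?_, hrep⟩, fun _ ↦ rfl⟩
  intro f
  obtain ⟨d, rfl⟩ := R.face_surjective f
  exact R.face_eq_iff.2 (h d)

lemma isPlane_of_connected [Finite V] (hG : G.Connected) (h : ∀ v, ∃ w, G.Adj v w)
    (hcard : 2 * (Nat.card V + Nat.card R.Face) = Nat.card G.Dart + 4) : R.IsPlane := by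
  classical
  have := Fintype.ofFinite V
  have h1 : Nat.card {v : V // ∀ w, ¬ G.Adj v w} = 0 := by
    rw [Nat.card_eq_zero]
    refine Or.inl ⟨fun v ↦ ?_⟩
    obtain ⟨w, hw⟩ := h v.1
    exact v.2 w hw
  have h2 : Nat.card G.ConnectedComponent = 1 := by
    have := hG.nonempty
    have := hG.preconnected.subsingleton_connectedComponent
    exact Nat.card_of_subsingleton (G.connectedComponentMk (Classical.arbitrary V))
  have h3 : Nat.card G.Dart = 2 * Nat.card G.edgeSet := by
    rw [Nat.card_eq_fintype_card, dart_card_eq_twice_card_edges, Nat.card_eq_fintype_card,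
      card_edgeSet]
  rw [IsPlane, h1, h2]
  lia

end RotationSystem

/-- The darts of the graph obtained by stacking octahedra into the faces of a triangulation, where
`d` runs through the sides of these faces. The dart `side d` is `d` itself; the darts `tailUp d` and
`headUp d` lead from the ends of `d` to the new vertex at `d`, and `tailDown d` and `headDown d` lead
back; the darts `fwd d` and `bwd d` lead from the new vertex at `d` to the following and the preceding
one in the same face. -/
inductive StackedDart (D : Type*)
  | side (d : D)
  | tailUp (d : D)
  | headUp (d : D)
  | tailDown (d : D)
  | headDown (d : D)
  | fwd (d : D)
  | bwd (d : D)

namespace StackedDart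

/-- Seven kinds of darts for each side. -/
def equivProd (D : Type*) : StackedDart D ≃ D × Fin 7 where
  toFun
    | side d => (d, 0)
    | tailUp d => (d, 1)
    | headUp d => (d, 2)
    | tailDown d => (d, 3)
    | headDown d => (d, 4)
    | fwd d => (d, 5)
    | bwd d => (d, 6)
  invFun
    | (d, 0) => side d
    | (d, 1) => tailUp d
    | (d, 2) => headUp d
    | (d, 3) => tailDown d
    | (d, 4) => headDown d
    | (d, 5) => fwd d
    | (d, 6) => bwd d
  left_inv x := by cases x <;> rfl
  right_inv := by
    rintro ⟨d, i⟩
    fin_cases i <;> rfl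

variable {V : Type*} {G : SimpleGraph V} (R : RotationSystem G)

/-- The rotation at the ends of the stacked darts. -/
def rot : Equiv.Perm (StackedDart G.Dart) where
  toFun
    | side d => headUp d.symm
    | headUp d => tailUp (R.next d)
    | tailUp d => side d
    | headDown d => tailDown d
    | tailDown d => bwd d
    | bwd d => fwd d
    | fwd d => headDown d
  invFun
    | headUp d => side d.symm
    | tailUp d => headUp (R.next.symm d)
    | side d => tailUp d
    | tailDown d => headDown d
    | bwd d => tailDown d
    | fwd d => bwd d
    | headDown d => fwd d
  left_inv x := by cases x <;> simp
  right_inv x := by cases x <;> simp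

/-- The reversal of a stacked dart. -/
def reverse : StackedDart G.Dart → StackedDart G.Dart
  | side d => side d.symm
  | tailUp d => tailDown d
  | headUp d => headDown d
  | tailDown d => tailUp d
  | headDown d => headUp d
  | fwd d => bwd (R.next d)
  | bwd d => fwd (R.next.symm d)

/-- The initial vertex of a stacked dart. -/
def tail : StackedDart G.Dart → R.Face ⊕ G.Dart
  | side d => .inl (R.face d)
  | tailUp d => .inl (R.face d)
  | headUp d => .inl (R.face d.symm)
  | tailDown d => .inr d
  | headDown d => .inr d
  | fwd d => .inr d
  | bwd d => .inr d

lemma tail_rot (x : StackedDart G.Dart) : tail R (rot R x) = tail R x := by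
  cases x <;> simp [tail, rot, R.face_next]

end StackedDart

namespace RotationSystem.IsSimplicialCubic

open StackedDart

variable {V : Type*} {G : SimpleGraph V} {R : RotationSystem G} (hR : R.IsSimplicialCubic)
include hR

lemma stacked_adj (x : StackedDart G.Dart) :
    R.octahedralStackedDual.Adj (tail R x) (tail R (reverse R x)) := by
  cases x with
  | side d => exact hR.dual_adj_face d
  | tailUp d => exact Or.inl rfl
  | headUp d => exact Or.inr rfl
  | tailDown d => exact Or.inl rfl
  | headDown d => exact Or.inr rfl
  | fwd d => exact ⟨(hR.next_ne d).symm, (R.next_fst d).symm⟩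
  | bwd d =>
    refine ⟨fun h ↦ hR.next_ne d ?_, ?_⟩
    · conv_lhs => rw [h]
      simp
    · have := R.next_fst (R.next.symm d)
      rwa [Equiv.apply_symm_apply] at this

lemma exists_stackedDart_equiv : ∃ e : StackedDart G.Dart ≃ R.octahedralStackedDual.Dart,
    ∀ x, (e x).toProd = (tail R x, tail R (reverse R x)) := by
  refine ⟨Equiv.ofBijective (fun x ↦ ⟨(tail R x, tail R (reverse R x)), hR.stacked_adj x⟩)
    ⟨?_, ?_⟩, fun _ ↦ rfl⟩
  · intro x y h
    have h1 : tail R x = tail R y := congrArg (fun z : R.octahedralStackedDual.Dart ↦ z.fst) h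
    have h2 : tail R (reverse R x) = tail R (reverse R y) :=
      congrArg (fun z : R.octahedralStackedDual.Dart ↦ z.snd) h
    have hp : ∀ d, R.next.symm d = R.next (R.next d) := fun d ↦ by
      rw [Equiv.symm_apply_eq, hR.next_three]
    have n1 := hR.next_ne
    -- Two darts with the same ends are told apart by dual simplicity (two sides), by the two faces
    -- at an edge being different, or by the rotation having order three.
    cases x <;> cases y <;> simp only [tail, reverse, Sum.inl.injEq, Sum.inr.injEq, reduceCtorEq,
      hp] at h1 h2
    all_goals first
      | (subst h1; rfl)
      | (subst h2; rfl)
      | (subst h1; exact absurd h2 (hR.face_ne _))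
      | (subst h2; exact absurd h1 (hR.face_ne _))
      | (subst h1; exact absurd h2 (hR.next_ne _))
      | (subst h1; exact absurd h2.symm (hR.next_ne _))
      | (rw [hR.dual_simple _ _ h1 h2])
  · rintro ⟨⟨f | d, g | e⟩, h⟩
    · obtain ⟨-, d, rfl, rfl⟩ := h
      exact ⟨side d, rfl⟩
    · rcases h with rfl | rfl
      · exact ⟨tailUp e, rfl⟩
      · exact ⟨headUp e, rfl⟩
    · rcases h with rfl | rfl
      · exact ⟨tailDown d, rfl⟩
      · exact ⟨headDown d, rfl⟩
    · obtain ⟨hne, hfst⟩ := h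
      rcases hR.eq_or_of_fst_eq hfst with rfl | rfl | rfl
      · exact absurd rfl hne
      · exact ⟨fwd d, rfl⟩
      · refine ⟨bwd d, Dart.ext _ _ (Prod.ext rfl (congrArg Sum.inr ?_))⟩
        rw [Equiv.symm_apply_eq, hR.next_three]

/-- Stacking octahedra preserves planarity. -/
theorem isPlanar_octahedralStackedDual [Finite V] : IsPlanar R.octahedralStackedDual := by
  classical
  refine ⟨inferInstance, ?_⟩
  obtain ⟨e, he⟩ := hR.exists_stackedDart_equiv
  have hfst : ∀ x, (e x).fst = tail R x := fun x ↦ congrArg Prod.fst (he x)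
  let N : Equiv.Perm R.octahedralStackedDual.Dart := e.symm.trans ((rot R).trans e)
  have hN : ∀ x, N (e x) = e (rot R x) := fun x ↦ by simp [N]
  have hstep : ∀ x, N.SameCycle (e x) (e (rot R x)) := fun x ↦ by
    rw [← hN]
    exact Equiv.Perm.sameCycle_apply_right.2 (.refl _ _)
  -- Three steps of the new rotation at a corner amount to one step of face tracing in `R`, so
  -- transitivity at the corner is inherited from the face.
  have hside : ∀ d d', R.face d = R.face d' → N.SameCycle (e (side d)) (e (side d')) := by
    intro d d' h
    refine rel_of_sameCycle (r := fun d d' ↦ N.SameCycle (e (side d)) (e (side d')))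
      (fun _ ↦ .refl _ _) (fun _ _ _ h h' ↦ h.trans h') (fun d ↦ ?_) (R.face_eq_iff.1 h)
    exact ((hstep (side d)).trans (hstep (headUp d.symm))).trans (hstep (tailUp (R.next d.symm)))
  let R' : RotationSystem R.octahedralStackedDual :=
    { next := N
      next_fst := by
        intro y
        obtain ⟨x, rfl⟩ := e.surjective y
        rw [hN, hfst, hfst, tail_rot]
      sameCycle := by
        intro y z h
        obtain ⟨x, rfl⟩ := e.surjective y
        obtain ⟨w, rfl⟩ := e.surjective z
        rw [hfst, hfst] at h
        have hl : ∀ x f, tail R x = .inl f → ∃ d, R.face d = f ∧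
            N.SameCycle (e x) (e (side d)) := by
          intro x f hx
          cases x <;> simp only [tail, Sum.inl.injEq, reduceCtorEq] at hx
          case side d => exact ⟨d, hx, .refl _ _⟩
          case tailUp d => exact ⟨d, hx, hstep (tailUp d)⟩
          case headUp d =>
            refine ⟨d.symm, hx, ?_⟩
            have := hstep (side d.symm)
            simp only [rot, Equiv.coe_fn_mk, Dart.symm_symm] at this
            exact this.symm
        have hr : ∀ x d, tail R x = .inr d → N.SameCycle (e x) (e (headDown d)) := by
          intro x d hx
          have h1 := hstep (fwd d)
          have h2 := (hstep (bwd d)).trans h1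
          have h3 := (hstep (tailDown d)).trans h2
          cases x <;> simp only [tail, Sum.inr.injEq, reduceCtorEq] at hx <;> subst hx
          · exact h3
          · exact .refl _ _
          · exact h1
          · exact h2
        cases hx : tail R x with
        | inl f =>
          obtain ⟨d, hd, h1⟩ := hl x f hx
          obtain ⟨d', hd', h2⟩ := hl w f (h ▸ hx)
          exact (h1.trans (hside d d' (hd.trans hd'.symm))).trans h2.symm
        | inr d => exact (hr x d hx).trans (hr w d (h ▸ hx)).symm }
  have hrev : ∀ x, (e x).symm = e (reverse R x) := by
    intro x
    apply Dart.ext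
    rw [Dart.symm_toProd, he, he]
    cases x <;> simp [reverse]
  have hstep' : ∀ x, R'.faceStep (e x) = e (rot R (reverse R x)) := fun x ↦ by
    rw [R'.faceStep_apply, hrev]
    exact hN _
  have hsame : ∀ x, R'.faceStep.SameCycle (e x) (e (rot R (reverse R x))) := fun x ↦ by
    rw [← hstep']
    exact Equiv.Perm.sameCycle_apply_right.2 (.refl _ _)
  choose b hb using hR.exists_dart
  -- The faces are all triangles: one on each side `d`, one at each corner between consecutive sides
  -- `d` and `R.next d`, and one inner triangle for each vertex of `G`.
  let label : StackedDart G.Dart → G.Dart ⊕ G.Dart ⊕ V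
    | side d => .inl d
    | headUp d => .inl d
    | tailDown d => .inl d
    | headDown d => .inr (.inl d)
    | tailUp d => .inr (.inl (R.next.symm d))
    | bwd d => .inr (.inl (R.next.symm d))
    | fwd d => .inr (.inr d.fst)
  let rep : G.Dart ⊕ G.Dart ⊕ V → StackedDart G.Dart
    | .inl d => side d
    | .inr (.inl d) => headDown d
    | .inr (.inr v) => fwd (b v)
  obtain ⟨φ, -⟩ := R'.exists_face_equiv (fun y ↦ label (e.symm y)) (fun l ↦ e (rep l)) (by
    intro y
    obtain ⟨x, rfl⟩ := e.surjective y
    rw [hstep']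
    cases x <;> simp [label, rot, reverse, R.next_fst]) (by
    intro l
    rcases l with d | d | v <;> simp [label, rep, hb]) (by
    intro y
    obtain ⟨x, rfl⟩ := e.surjective y
    simp only [Equiv.symm_apply_apply]
    have f1 : ∀ d, R'.faceStep.SameCycle (e (fwd d)) (e (fwd (R.next d))) := fun d ↦
      hsame (fwd d)
    cases x with
    | side d => exact .refl _ _
    | headUp d => exact hsame (side d)
    | tailDown d => exact (hsame (side d)).trans (hsame (headUp d))
    | headDown d => exact .refl _ _
    | tailUp d =>
      have := hsame (headDown (R.next.symm d))
      simpa [rot, reverse] using this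
    | bwd d =>
      have := hsame (headDown (R.next.symm d))
      simp only [rot, reverse, Equiv.coe_fn_mk, Equiv.apply_symm_apply] at this
      exact this.trans (hsame (tailUp d))
    | fwd d =>
      have hfwd : ∀ a d, a.fst = d.fst → R'.faceStep.SameCycle (e (fwd a)) (e (fwd d)) := by
        intro a d h
        rcases hR.eq_or_of_fst_eq h with rfl | rfl | rfl
        · exact .refl _ _
        · exact f1 a
        · exact (f1 a).trans (f1 (R.next a))
      exact hfwd _ _ (hb d.fst))
  refine ⟨R', R'.isPlane_of_connected ?_ ?_ ?_⟩
  · obtain ⟨v⟩ := hR.connected.nonempty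
    let c : R.Face → Bool := fun f ↦
      decide (R.octahedralStackedDual.Reachable (.inl (R.face (b v))) (.inl f))
    have hc := hR.face_eq_const c (fun d ↦ by
      have hadj : R.octahedralStackedDual.Adj (.inl (R.face d)) (.inl (R.face d.symm)) :=
        hR.dual_adj_face d
      simp only [c, decide_eq_decide]
      exact ⟨fun h ↦ h.trans hadj.reachable, fun h ↦ h.trans hadj.symm.reachable⟩)
    have hreach : ∀ f, R.octahedralStackedDual.Reachable (.inl (R.face (b v))) (.inl f) :=
      fun f ↦ of_decide_eq_true ((hc f (R.face (b v))).trans (decide_eq_true (.refl _)))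
    refine connected_iff_exists_forall_reachable _ |>.2 ⟨.inl (R.face (b v)), ?_⟩
    rintro (f | d)
    · exact hreach f
    · have hadj : R.octahedralStackedDual.Adj (.inl (R.face d)) (.inr d) := Or.inl rfl
      exact (hreach _).trans hadj.reachable
  · rintro (f | d)
    · obtain ⟨d, rfl⟩ := R.face_surjective f
      exact ⟨.inr d, Or.inl rfl⟩
    · exact ⟨.inl (R.face d), Or.inl rfl⟩
  -- With `|D| = 3V` there are `F + 3V` vertices, `7V` faces and `21V` darts, so Euler's formula
  -- reduces to `V + 4 = 2F`.
  · have h1 := hR.card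
    have h2 := hR.card_dart
    rw [Nat.card_congr φ, ← Nat.card_congr e, Nat.card_congr (equivProd G.Dart), Nat.card_prod]
    simp only [Nat.card_sum, Nat.card_eq_fintype_card (α := Fin 7), Fintype.card_fin]
    lia

theorem isPlane [Finite V] : R.IsPlane := by
  refine R.isPlane_of_connected hR.connected ?_ ?_
  · intro v
    obtain ⟨d, rfl⟩ := hR.exists_dart v
    exact ⟨d.snd, d.adj⟩
  · have h1 := hR.card
    have h2 := hR.card_dart
    lia

end RotationSystem.IsSimplicialCubic
end PlanarPartition

/-! ### Explicit tables for the Grinberg graph and their finite checks. -/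

namespace PlanarPartition

open SimpleGraph

namespace GrinbergGraph

/-- The table of `reverse`: the `i`-th entry of the `v`-th row is `3 * w + j` if the `i`-th dart
leaving `v` is the reversal of the `j`-th dart leaving `w`. -/
def reverseTable : List (List ℕ) := [
    [3, 6, 9], [0, 12, 15], [1, 18, 21], [2, 24, 13], [4, 11, 27], [5, 30, 33], [7, 36, 39],
    [8, 42, 25], [10, 23, 45], [14, 48, 31], [16, 29, 51], [17, 54, 57], [19, 59, 60],
    [20, 63, 43], [22, 41, 66], [26, 68, 69], [28, 72, 75], [32, 77, 55], [34, 53, 78],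
    [35, 81, 37], [38, 84, 64], [40, 62, 87], [44, 90, 46], [47, 93, 73], [49, 71, 96],
    [50, 99, 52], [56, 102, 82], [58, 80, 85], [61, 83, 105], [65, 107, 108], [67, 111, 94],
    [70, 92, 114], [74, 116, 100], [76, 98, 117], [79, 120, 106], [86, 104, 88], [89, 122, 112],
    [91, 110, 123], [95, 125, 97], [101, 124, 121], [103, 119, 109], [113, 118, 115]]

/-- The table of `faceLabel`, indexed in the same way. -/
def faceTable : List (List ℕ) := [
    [0, 1, 2], [1, 0, 4], [2, 1, 9], [0, 2, 3], [4, 0, 3], [1, 4, 5], [9, 1, 8], [2, 9, 10],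
    [3, 2, 10], [4, 3, 14], [5, 4, 14], [1, 5, 6], [8, 1, 7], [9, 8, 18], [10, 9, 18],
    [3, 10, 11], [14, 3, 13], [5, 14, 15], [6, 5, 15], [1, 6, 7], [8, 7, 17], [18, 8, 17],
    [10, 18, 11], [3, 11, 12], [13, 3, 12], [14, 13, 15], [6, 15, 16], [7, 6, 16], [17, 7, 16],
    [18, 17, 22], [11, 18, 19], [12, 11, 19], [13, 12, 20], [15, 13, 20], [16, 15, 22],
    [17, 16, 22], [18, 22, 21], [19, 18, 21], [12, 19, 20], [15, 20, 21], [22, 15, 21],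
    [19, 21, 20]]

/-- The index `3 * v + i` of the first dart of each face. -/
def faceRepTable : List ℕ := [
     0, 1, 2, 11, 5, 17, 35, 38, 20, 8, 23, 47, 71, 50, 29, 53, 80, 62, 41, 92, 98, 110, 89]

/-- The dart with a given index. -/
def ofIndex (k : ℕ) : Fin 42 × Fin 3 := (Fin.ofNat 42 (k / 3), Fin.ofNat 3 (k % 3))

/-- The reversal of the `i`-th dart leaving `v`. -/
def reverse (x : Fin 42 × Fin 3) : Fin 42 × Fin 3 := ofIndex ((reverseTable.getD x.1 []).getD x.2 0)

/-- The face on the fixed side of a dart. -/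
def faceLabel (x : Fin 42 × Fin 3) : Fin 23 := Fin.ofNat 23 ((faceTable.getD x.1 []).getD x.2 0)

/-- A dart of a given face. -/
def faceRep (f : Fin 23) : Fin 42 × Fin 3 := ofIndex (faceRepTable.getD f 0)

/-- The rotation of the darts leaving a vertex. -/
def rotation : Equiv.Perm (Fin 42 × Fin 3) := (Equiv.refl _).prodCongr (Equiv.addRight 1)

/-- One step of face tracing. -/
def step (x : Fin 42 × Fin 3) : Fin 42 × Fin 3 :=
  let y := reverse x
  (y.1, y.2 + 1)

lemma reverse_reverse (x : Fin 42 × Fin 3) : reverse (reverse x) = x := by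
  have : ∀ v i, reverse (reverse (v, i)) = (v, i) := by decide +kernel
  exact this x.1 x.2

lemma reverse_fst_ne (x : Fin 42 × Fin 3) : (reverse x).1 ≠ x.1 := by
  have : ∀ v i, (reverse (v, i)).1 ≠ v := by decide +kernel
  exact this x.1 x.2

lemma reverse_fst_injective (v : Fin 42) (i j : Fin 3)
    (h : (reverse (v, i)).1 = (reverse (v, j)).1) : i = j := by
  have : ∀ v i j, (reverse (v, i)).1 = (reverse (v, j)).1 → i = j := by decide +kernel
  exact this v i j h

/-- The numbering makes dart 0 of each nonzero vertex lead to a smaller vertex, so connectedness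
follows by induction. -/
lemma reverse_zero_fst_lt (v : Fin 42) (hv : v ≠ 0) : (reverse (v, 0)).1 < v := by
  have : ∀ v ≠ 0, (reverse (v, 0)).1 < v := by decide +kernel
  exact this v hv

lemma faceLabel_step (x : Fin 42 × Fin 3) : faceLabel (step x) = faceLabel x := by
  have : ∀ v i, faceLabel (step (v, i)) = faceLabel (v, i) := by decide +kernel
  exact this x.1 x.2

lemma faceLabel_faceRep (f : Fin 23) : faceLabel (faceRep f) = f := by
  have : ∀ f, faceLabel (faceRep f) = f := by decide +kernel
  exact this f

/-- No face has more than 8 darts, so 8 steps suffice. Later checks range over steps within given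
faces instead of over all pairs or triples of darts. -/
lemma exists_step_faceRep (x : Fin 42 × Fin 3) :
    ∃ k : Fin 8, step^[k] (faceRep (faceLabel x)) = x := by
  have : ∀ v i, ∃ k : Fin 8, step^[k] (faceRep (faceLabel (v, i))) = (v, i) := by decide +kernel
  exact this x.1 x.2

lemma faceLabel_reverse_ne (x : Fin 42 × Fin 3) : faceLabel x ≠ faceLabel (reverse x) := by
  have : ∀ v i, faceLabel (v, i) ≠ faceLabel (reverse (v, i)) := by decide +kernel
  exact this x.1 x.2

lemma eq_of_faceLabel_eq (x y : Fin 42 × Fin 3) (h : faceLabel x = faceLabel y)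
    (h' : faceLabel (reverse x) = faceLabel (reverse y)) : x = y := by
  have key : ∀ f, ∀ k l : Fin 8,
      faceLabel (reverse (step^[k] (faceRep f))) = faceLabel (reverse (step^[l] (faceRep f))) →
        step^[k] (faceRep f) = step^[l] (faceRep f) := by
    decide +kernel
  obtain ⟨k, hk⟩ := exists_step_faceRep x
  obtain ⟨l, hl⟩ := exists_step_faceRep y
  rw [← h] at hl
  have := key (faceLabel x) k l
  rw [hk, hl] at this
  exact this h'

lemma faceLabel_of_triangle (x y z : Fin 42 × Fin 3) (hy : faceLabel y = faceLabel x)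
    (hz : faceLabel z = faceLabel (reverse x))
    (hyz : faceLabel (reverse y) = faceLabel (reverse z)) :
    faceLabel (reverse y) = faceLabel (x.1, x.2 + 2) ∨
      faceLabel (reverse y) = faceLabel ((reverse x).1, (reverse x).2 + 2) := by
  have key : ∀ v i, ∀ k l : Fin 8,
      faceLabel (reverse (step^[k] (faceRep (faceLabel (v, i))))) =
        faceLabel (reverse (step^[l] (faceRep (faceLabel (reverse (v, i)))))) →
      faceLabel (reverse (step^[k] (faceRep (faceLabel (v, i))))) = faceLabel (v, i + 2) ∨
      faceLabel (reverse (step^[k] (faceRep (faceLabel (v, i))))) =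
        faceLabel ((reverse (v, i)).1, (reverse (v, i)).2 + 2) := by
    decide +kernel
  obtain ⟨k, hk⟩ := exists_step_faceRep y
  obtain ⟨l, hl⟩ := exists_step_faceRep z
  have := key x.1 x.2 k l
  rw [← hy, ← hz, hk, hl] at this
  exact this hyz

/-- Face 0 is the quadrilateral; the others have 5 or 8 darts. -/
lemma card_faceLabel_eq (f : Fin 23) (hf : f ≠ 0) :
    Fintype.card {x : Fin 42 × Fin 3 // faceLabel x = f} % 3 = 2 := by
  have : ∀ f ≠ 0, Fintype.card {x : Fin 42 × Fin 3 // faceLabel x = f} % 3 = 2 := by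
    decide +kernel
  exact this f hf

end GrinbergGraph

end PlanarPartition

/-! ### The Grinberg graph as a simplicial cubic map. -/

namespace PlanarPartition

open SimpleGraph

namespace GrinbergGraph

/-- The Grinberg graph on `42` vertices: its faces are a quadrilateral, `18` pentagons and
`4` octagons. -/
def graph : SimpleGraph (Fin 42) where
  Adj v w := ∃ i, (reverse (v, i)).1 = w
  symm := ⟨by
    rintro v w ⟨i, rfl⟩
    exact ⟨(reverse (v, i)).2, by rw [Prod.mk.eta, reverse_reverse]⟩⟩
  loopless := ⟨fun v ⟨i, h⟩ ↦ reverse_fst_ne (v, i) h⟩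

/-- The darts of the Grinberg graph. -/
def dart (x : Fin 42 × Fin 3) : graph.Dart := ⟨(x.1, (reverse x).1), x.2, rfl⟩

lemma dart_bijective : Function.Bijective dart := by
  constructor
  · rintro ⟨v, i⟩ ⟨w, j⟩ h
    obtain rfl : v = w := congrArg (fun d : graph.Dart ↦ d.fst) h
    rw [reverse_fst_injective v i j (congrArg (fun d : graph.Dart ↦ d.snd) h)]
  · rintro ⟨⟨v, w⟩, i, h⟩
    exact ⟨(v, i), Dart.ext _ _ (Prod.ext rfl h)⟩

lemma dart_symm (x : Fin 42 × Fin 3) : (dart x).symm = dart (reverse x) := by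
  apply Dart.ext
  simp [dart, reverse_reverse]

/-- The embedding of the Grinberg graph in the plane. -/
noncomputable def rotationSystem : RotationSystem graph where
  next := (Equiv.ofBijective dart dart_bijective).permCongr rotation
  next_fst d := by
    obtain ⟨x, rfl⟩ := dart_bijective.2 d
    rw [Equiv.permCongr_apply, Equiv.ofBijective_symm_apply_apply]
    rfl
  sameCycle d e h := by
    obtain ⟨x, rfl⟩ := dart_bijective.2 d
    obtain ⟨y, rfl⟩ := dart_bijective.2 e
    have hN : ∀ x, (Equiv.ofBijective dart dart_bijective).permCongr rotation (dart x) =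
        dart (rotation x) := fun x ↦ by
      rw [Equiv.permCongr_apply, Equiv.ofBijective_symm_apply_apply]
      rfl
    have hstep := fun x ↦ hN x ▸
      Equiv.Perm.sameCycle_apply_right.2 (Equiv.Perm.SameCycle.refl _ (dart x))
    obtain ⟨v, i⟩ := x
    obtain ⟨w, j⟩ := y
    obtain rfl : v = w := h
    have key : ∀ i j : Fin 3, j = i ∨ j = i + 1 ∨ j = i + 1 + 1 := by decide
    rcases key i j with rfl | rfl | rfl
    · exact .refl _ _
    · exact hstep (v, i)
    · exact (hstep (v, i)).trans (hstep (v, i + 1))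

lemma next_dart (x : Fin 42 × Fin 3) :
    rotationSystem.next (dart x) = dart (x.1, x.2 + 1) := by
  change (Equiv.ofBijective dart dart_bijective).permCongr rotation (dart x) = _
  rw [Equiv.permCongr_apply, Equiv.ofBijective_symm_apply_apply]
  rfl

lemma faceStep_dart (x : Fin 42 × Fin 3) : rotationSystem.faceStep (dart x) = dart (step x) := by
  rw [RotationSystem.faceStep_apply, dart_symm, next_dart]
  rfl

lemma exists_faceEquiv :
    ∃ e : rotationSystem.Face ≃ Fin 23, ∀ x, e (rotationSystem.face (dart x)) = faceLabel x := by
  let E := Equiv.ofBijective dart dart_bijective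
  have hE : ∀ x, E.symm (dart x) = x := E.symm_apply_apply
  obtain ⟨e, he⟩ := rotationSystem.exists_face_equiv (fun d ↦ faceLabel (E.symm d))
    (fun f ↦ dart (faceRep f))
    (fun d ↦ by
      obtain ⟨x, rfl⟩ := dart_bijective.2 d
      rw [faceStep_dart, hE, hE, faceLabel_step])
    (fun f ↦ by rw [hE, faceLabel_faceRep])
    (fun d ↦ by
      obtain ⟨x, rfl⟩ := dart_bijective.2 d
      rw [hE]
      obtain ⟨k, hk⟩ := exists_step_faceRep x
      have : ∀ k : ℕ, ∀ y, rotationSystem.faceStep.SameCycle (dart y) (dart (step^[k] y)) := by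
        intro k
        induction k with
        | zero => exact fun y ↦ .refl _ _
        | succ k ih =>
          intro y
          rw [Function.iterate_succ_apply']
          rw [← faceStep_dart]
          exact Equiv.Perm.sameCycle_apply_right.2 (ih y)
      have := this k (faceRep (faceLabel x))
      rwa [hk] at this)
  exact ⟨e, fun x ↦ by rw [he, hE]⟩

lemma face_dart_eq_iff (x y : Fin 42 × Fin 3) :
    rotationSystem.face (dart x) = rotationSystem.face (dart y) ↔ faceLabel x = faceLabel y := by
  obtain ⟨e, he⟩ := exists_faceEquiv
  rw [← he, ← he, e.injective.eq_iff]

lemma connected : graph.Connected := by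
  rw [connected_iff_exists_forall_reachable]
  refine ⟨0, fun v ↦ ?_⟩
  induction v using WellFoundedLT.induction with
  | ind v ih =>
    rcases eq_or_ne v 0 with rfl | hv
    · exact .refl _
    · have hadj : graph.Adj v (reverse (v, 0)).1 := ⟨0, rfl⟩
      exact (ih _ (reverse_zero_fst_lt v hv)).trans hadj.symm.reachable

theorem isSimplicialCubic : rotationSystem.IsSimplicialCubic where
  connected := connected
  exists_dart v := ⟨dart (v, 0), rfl⟩
  next_three d := by
    obtain ⟨⟨v, i⟩, rfl⟩ := dart_bijective.2 d
    have key : ∀ i : Fin 3, i + 1 + 1 + 1 = i := by decide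
    rw [next_dart, next_dart, next_dart]
    simp only [key]
  next_ne d := by
    obtain ⟨⟨v, i⟩, rfl⟩ := dart_bijective.2 d
    rw [next_dart, dart_bijective.1.ne_iff]
    simp
  card := by
    obtain ⟨e, -⟩ := exists_faceEquiv
    rw [Nat.card_congr e, Nat.card_fin, Nat.card_fin]
  face_ne d := by
    obtain ⟨x, rfl⟩ := dart_bijective.2 d
    rw [dart_symm, Ne, face_dart_eq_iff]
    exact faceLabel_reverse_ne x
  dual_simple d e h h' := by
    obtain ⟨x, rfl⟩ := dart_bijective.2 d
    obtain ⟨y, rfl⟩ := dart_bijective.2 e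
    rw [dart_symm, dart_symm, face_dart_eq_iff] at h'
    rw [eq_of_faceLabel_eq x y ((face_dart_eq_iff x y).1 h) h']
  triangle_facial d h := by
    rintro ⟨-, e, he, rfl⟩ ⟨-, f, hf, hef⟩
    obtain ⟨x, rfl⟩ := dart_bijective.2 d
    obtain ⟨y, rfl⟩ := dart_bijective.2 e
    obtain ⟨z, rfl⟩ := dart_bijective.2 f
    rw [dart_symm, face_dart_eq_iff] at hf
    rw [dart_symm, dart_symm, face_dart_eq_iff] at hef
    rw [face_dart_eq_iff] at he
    have key : ∀ i : Fin 3, i + 1 + 1 = i + 2 := by decide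
    simp only [dart_symm, next_dart, face_dart_eq_iff, key]
    exact faceLabel_of_triangle x y z he hf hef.symm

lemma exists_face_forall_card :
    ∃ f₀ : rotationSystem.Face, ∀ f ≠ f₀,
      Nat.card {d : graph.Dart // rotationSystem.face d = f} % 3 = 2 := by
  obtain ⟨e, he⟩ := exists_faceEquiv
  refine ⟨e.symm 0, fun f hf ↦ ?_⟩
  rw [← card_faceLabel_eq (e f) (fun h ↦ hf (by rw [← h, e.symm_apply_apply])),
    ← Nat.card_eq_fintype_card]
  congr 1
  refine (Nat.card_congr ((Equiv.ofBijective dart dart_bijective).subtypeEquiv fun x ↦ ?_)).symm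
  rw [Equiv.ofBijective_apply, ← he, e.injective.eq_iff]

end GrinbergGraph

end PlanarPartition

theorem mainTheorem3 :
    ∃ (n : ℕ) (H : SimpleGraph (Fin n)) (R : PlanarPartition.RotationSystem H),
      R.IsPlane ∧
      PlanarPartition.IsCubic H ∧
      PlanarPartition.IsThreeConnected H ∧
      PlanarPartition.IsCyclicallyFourEdgeConnected H ∧
      ¬ H.IsHamiltonian ∧
      PlanarPartition.IsPlanar R.octahedralStackedDual ∧
      ¬ PlanarPartition.HasForestTriangleForestPartition R.octahedralStackedDual := by
  have hR := PlanarPartition.GrinbergGraph.isSimplicialCubic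
  obtain ⟨f₀, hf₀⟩ := PlanarPartition.GrinbergGraph.exists_face_forall_card
  have hV : Nat.card (Fin 42) % 3 ≠ 2 := by simp
  exact ⟨42, PlanarPartition.GrinbergGraph.graph, PlanarPartition.GrinbergGraph.rotationSystem,
    hR.isPlane, hR.isCubic, hR.isThreeConnected (by simp), hR.isCyclicallyFourEdgeConnected,
    hR.not_isHamiltonian hV f₀ hf₀, hR.isPlanar_octahedralStackedDual,
    hR.not_hasForestTriangleForestPartition hV f₀ hf₀⟩
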